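/- Let $E$ be a standard Borel space, $P_X$ a probability measure on $E$, $\Delta:E\times E\to[0,\infty)$ a measurable distortion function, and $f:(0,\infty)\to\mathbb R$ convex with $f(1)=0$. For probability measures $\mu,\nu$ on $E$ let $D_f(\mu\|\nu)=\int f\big(\tfrac{d\mu}{d\nu}\big)\,d\nu+f'(\infty)\,\mu_s(E)$ be the $f$-divergence, where $\tfrac{d\mu}{d\nu}$ is the density of the absolutely continuous part of $\mu$, $\mu_s$ is the part of $\mu$ singular to $\nu$, $f(0)=\lim_{t\downarrow0}f(t)$ and $f'(\infty)=\lim_{t\to\infty}f(t)/t$. The rate-distortion-perception function is $$R(D,p)=\inf\big\{I(X;\hat X)\;:\;P_{\hat X|X},\ \mathbb E[\Delta(X,\hat X)]\le D,\ D_f(P_X\|P_{\hat X})\le p\big\},$$ with mutual information in nats and $X\sim P_X$. Let $P_{\hat X|X}$ be a channel with output marginal $Q$, with $D=\mathbb E[\Delta(X,\hat X)]<\infty$ and $p=D_f(P_X\|Q)<\infty$, that achieves $R(D,p)$, and assume $R(D,p)<\infty$. Let $\beta_1,\beta_2>0$ be Lagrange multipliers for this problem, i.e. for every channel $P_{\tilde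 X|X}$, $$R(D,p)\le I(X;\tilde X)+\beta_1\big(\mathbb E[\Delta(X,\tilde X)]-D\big)+\beta_2\big(D_f(P_X\|P_{\tilde X})-p\big).$$ Then there is a measurable function $\xi:E\to\mathbb R$ such that, for $Q$-almost every $y$ with $\tfrac{dP_X}{dQ}(y)>0$, $\xi(y)$ is a subgradient of $f$ at $\tfrac{dP_X}{dQ}(y)$ (so $\xi(y)=f'\big(\tfrac{dP_X}{dQ}(y)\big)$ wherever $f$ is differentiable there), and such that, with $$g(y)=g(P_X,Q,y)=f\Big(\frac{dP_X}{dQ}(y)\Big)-\frac{dP_X}{dQ}(y)\,\xi(y),$$ the following two statements hold. 1. For $P_X$-almost every $x$, the measures $P_{\hat X|X}(\cdot|x)$ and $Q$ are mutually absolutely continuous, $e^{-\beta_1\Delta(x,\cdot)-\beta_2 g}$ is $Q$-integrable, and for $Q$-almost every $y$ $$\frac{dP_{\hat X|X}(\cdot|x)}{dQ}(y)=\frac{e^{-\beta_1\Delta(x,y)-\beta_2 g(y)}}{\mathbb E_{\hat X'\sim Q}\big[e^{-\beta_1\Delta(x,\hat X')-\beta_2 g(\hat X')}\big]}.$$ 2.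 Let $\tau_1,\tau_2,\dots$ be i.i.d. $\mathrm{Exp}(1)$ and, independently of them, $\hat X_1,\hat X_2,\dots$ i.i.d. with law $Q$, and let $W_i=\sum_{j\le i}\tau_j$. Then for $P_X$-almost every $x$, almost surely, an index $k$ minimizes $$W_i\,\frac{dQ}{dP_{\hat X|X}(\cdot|x)}(\hat X_i)$$ over $i\ge1$ if and only if it minimizes $$\Delta(x,\hat X_i)+\frac{\beta_2}{\beta_1}\,g(P_X,Q,\hat X_i)+\frac1{\beta_1}\ln W_i .$$ That is, the Poisson functional representation's index selection is a regularized minimum-distance search over the random codebook. -/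

import Mathlib

open MeasureTheory ProbabilityTheory Filter Topology
open scoped ENNReal

universe u v

noncomputable section

namespace RDP

/-! ### `f`-divergences -/

/-- A generator `f : (0, ∞) → ℝ` extended to `0` by its right limit `f(0+)`, which may be `+∞`.
Only the values of `f` on `(0, ∞)` are used. -/
def genExt (f : ℝ → ℝ) (t : ℝ≥0∞) : EReal :=
  if t = 0 then limsup (fun u : ℝ => (f u : EReal)) (𝓝[>] (0 : ℝ)) else (f t.toReal : EReal)

/-- The slope at infinity `f'(∞) = lim f(t) / t`, which may be `+∞`. -/
def slopeAtTop (f : ℝ → ℝ) : EReal :=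
  limsup (fun u : ℝ => ((f u / u : ℝ) : EReal)) atTop

/-- The `f`-divergence `D_f(μ ‖ ν) = ∫ f(dμ/dν) dν + f'(∞) μ_s(E)`, where `μ_s` is the part of `μ`
that is singular to `ν`.  The integral is the difference of the integrals of the positive and of
the negative part; the latter is finite for convex `f` and finite measures. -/
def fDiv {E : Type*} [MeasurableSpace E] (f : ℝ → ℝ) (μ ν : Measure E) : EReal :=
  ((∫⁻ y, (genExt f (μ.rnDeriv ν y)).toENNReal ∂ν : ℝ≥0∞) : EReal)
    - ((∫⁻ y, (-genExt f (μ.rnDeriv ν y)).toENNReal ∂ν : ℝ≥0∞) : EReal)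
    + slopeAtTop f * ((μ.singularPart ν Set.univ : ℝ≥0∞) : EReal)

/-- `ξ ∈ ∂f(s)`: `ξ` is a subgradient at `s` of the function `f` on `(0, ∞)`. -/
def IsSubgradient (f : ℝ → ℝ) (s ξ : ℝ) : Prop :=
  ∀ t : ℝ, 0 < t → f s + ξ * (t - s) ≤ f t

/-- Where `f` is differentiable, its only subgradient is the derivative. -/
theorem IsSubgradient.eq_deriv {f : ℝ → ℝ} {s ξ : ℝ} (h : IsSubgradient f s ξ) (hs : 0 < s)
    (hf : DifferentiableAt ℝ f s) : ξ = deriv f s := by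
  have hmin : IsLocalMin (fun t => f t - ξ * t) s := by
    filter_upwards [Ioi_mem_nhds hs] with t ht
    have := h t ht
    linarith
  have hd : HasDerivAt (fun t => f t - ξ * t) (deriv f s - ξ * 1) s :=
    hf.hasDerivAt.sub ((hasDerivAt_id s).const_mul ξ)
  have := hmin.hasDerivAt_eq_zero hd
  linarith

/-! ### The rate-distortion-perception problem -/

section Problem

variable {E : Type*} [MeasurableSpace E]

/-- The mutual information `I(X; X̂)`, in nats, of `(X, X̂) ∼ P ⊗ κ`. -/
def mutualInfo (P : Measure E) (κ : Kernel E E) : ℝ≥0∞ :=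
  InformationTheory.klDiv (P ⊗ₘ κ) (P.prod (κ ∘ₘ P))

/-- The expected distortion `𝔼[Δ(X, X̂)]` of `(X, X̂) ∼ P ⊗ κ`, for `Δ ≥ 0`. -/
def expDistortion (P : Measure E) (Δ : E → E → ℝ) (κ : Kernel E E) : ℝ≥0∞ :=
  ∫⁻ p, ENNReal.ofReal (Δ p.1 p.2) ∂(P ⊗ₘ κ)

/-- The channel `κ` satisfies the distortion constraint `D` and the perception constraint `p`. -/
def IsFeasible (P : Measure E) (Δ : E → E → ℝ) (f : ℝ → ℝ) (D p : ℝ) (κ : Kernel E E) : Prop :=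
  (expDistortion P Δ κ : EReal) ≤ (D : EReal) ∧ fDiv f P (κ ∘ₘ P) ≤ (p : EReal)

/-- The rate-distortion-perception function `R(D, p)` with perception `D_f(P_X ‖ P_X̂)`. -/
def rdpFunction (P : Measure E) (Δ : E → E → ℝ) (f : ℝ → ℝ) (D p : ℝ) : ℝ≥0∞ :=
  ⨅ (κ : Kernel E E) (_ : IsMarkovKernel κ) (_ : IsFeasible P Δ f D p κ), mutualInfo P κ

/-- The channel `κ` achieves the infimum in the definition of `R(D, p)`. -/
def IsRDPAchieving (P : Measure E) (Δ : E → E → ℝ) (f : ℝ → ℝ) (D p : ℝ) (κ : Kernel E E) :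
    Prop :=
  IsFeasible P Δ f D p κ ∧ mutualInfo P κ = rdpFunction P Δ f D p

/-- `(β₁, β₂)` are Lagrange multipliers of the minimization problem defining `R(D, p)`:
they are nonnegative and the infimum over all channels of the Lagrangian
`I(X; X̂) + β₁ (𝔼[Δ(X, X̂)] - D) + β₂ (D_f(P_X ‖ P_X̂) - p)` is (at least) `R(D, p)`.
The constants are moved to the left, so that no difference of infinite terms occurs. -/
def IsLagrangeMultiplier (P : Measure E) (Δ : E → E → ℝ) (f : ℝ → ℝ) (D p β₁ β₂ : ℝ) : Prop :=
  0 ≤ β₁ ∧ 0 ≤ β₂ ∧ ∀ κ : Kernel E E, IsMarkovKernel κ →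
    (rdpFunction P Δ f D p : EReal) + ((β₁ * D + β₂ * p : ℝ) : EReal) ≤
      (mutualInfo P κ : EReal) + (β₁ : EReal) * (expDistortion P Δ κ : EReal)
        + (β₂ : EReal) * fDiv f P (κ ∘ₘ P)

/-- `g(P, Q, y) = f(dP/dQ(y)) - dP/dQ(y) ξ(y)`, where `ξ(y)` stands for `∂f(dP/dQ(y))`. -/
def perceptionPenalty (f : ℝ → ℝ) (ξ : E → ℝ) (P Q : Measure E) (y : E) : ℝ :=
  (genExt f (P.rnDeriv Q y)).toReal - (P.rnDeriv Q y).toReal * ξ y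

/-- The weight `exp(-β₁ Δ(x, y) - β₂ g(P, Q, y))`. -/
def gibbsWeight (Δ : E → E → ℝ) (f : ℝ → ℝ) (ξ : E → ℝ) (P Q : Measure E) (β₁ β₂ : ℝ)
    (x y : E) : ℝ :=
  Real.exp (-(β₁ * Δ x y) - β₂ * perceptionPenalty f ξ P Q y)

end Problem

/-! ### One-shot reverse channel coding by the Poisson functional representation -/

/-- The shared randomness: `τ₀, τ₁, …` i.i.d. `Exp(1)` and, independently of them, codewords
`X̂₀, X̂₁, …` i.i.d. with law `Q`. -/
structure IsPoissonCodebook {Ω E : Type*} [MeasurableSpace Ω] [MeasurableSpace E]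
    (μ : Measure Ω) (Q : Measure E) (τ : ℕ → Ω → ℝ) (Xhat : ℕ → Ω → E) : Prop where
  measurable_time : ∀ i, Measurable (τ i)
  measurable_codeword : ∀ i, Measurable (Xhat i)
  law_time : ∀ i, μ.map (τ i) = expMeasure 1
  law_codeword : ∀ i, μ.map (Xhat i) = Q
  indep_time : iIndepFun τ μ
  indep_codeword : iIndepFun Xhat μ
  indep : IndepFun (fun ω i => τ i ω) (fun ω i => Xhat i ω) μ

/-- The arrival times `W_i = τ_0 + … + τ_i` (indices start at `0`). -/
def arrival {Ω : Type*} (τ : ℕ → Ω → ℝ) (i : ℕ) (ω : Ω) : ℝ :=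
  ∑ j ∈ Finset.range (i + 1), τ j ω

/-- The quantity `W_i · dQ/dκₓ(X̂_i)` that the encoder minimizes over `i`, where
`κₓ = P_{X̂|X}(· | x)`. -/
def pfrObjective {Ω E : Type*} [MeasurableSpace E] (Q κₓ : Measure E) (τ : ℕ → Ω → ℝ)
    (Xhat : ℕ → Ω → E) (ω : Ω) (i : ℕ) : ℝ≥0∞ :=
  ENNReal.ofReal (arrival τ i ω) * Q.rnDeriv κₓ (Xhat i ω)

/-- The regularized distance `Δ(x, X̂_i) + (β₂/β₁) g(P, Q, X̂_i) + (1/β₁) ln W_i`. -/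
def vqObjective {Ω E : Type*} [MeasurableSpace E] (Δ : E → E → ℝ) (f : ℝ → ℝ) (ξ : E → ℝ)
    (P Q : Measure E) (β₁ β₂ : ℝ) (τ : ℕ → Ω → ℝ) (Xhat : ℕ → Ω → E) (x : E) (ω : Ω)
    (i : ℕ) : ℝ :=
  Δ x (Xhat i ω) + β₂ / β₁ * perceptionPenalty f ξ P Q (Xhat i ω)
    + 1 / β₁ * Real.log (arrival τ i ω)

end RDP

end

/-!
The Lagrangian `I(X; X̂) + β₁ 𝔼[Δ] + β₂ D_f(P ‖ P_X̂)` is minimized by the given channel, and the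
theorem is its first-order condition.  Let `Q` be the output law, `r(x, y)` the density of the
channel with respect to `Q`, and `s = dP/dQ`.  If another channel has the density `ρ(x, y)` with
respect to `Q`, and its output law the density `q(y)`, then `I(X; X̂)` is at most the divergence of
its joint law from `P × Q` (`mutualInfo_le_klDiv_prod`), with equality for `r`, and
`D_f(P ‖ P_X̂)` is a constant plus `∫ q f(s / q) dQ` (`fDiv_withDensity`).  So `r` minimizes a sum
of `∫ klFun ρ d(P × Q)`, a term linear in `ρ` and `∫ h_y(q(y)) dQ`, where `h_y(q) = q f(s(y) / q)`
is convex (`exists_isOptimalDensity`).  All perturbations below leave `q = 1` outside of a set on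
which the slopes of `h_y` near `1` are bounded, because `f(s) - s f'(s)` need not be integrable.

* `r > 0` almost everywhere: shifting a mass of order `t` to `{r = 0}` changes the information by
  an amount of order `t log t < 0` and everything else by `O(t)` (`IsOptimalDensity.ae_pos`).
* For perturbations `r (1 + t φ)` with `∫ φ r dQ = 0` the derivative at `t = 0+` is nonnegative
  (`IsOptimalDensity.first_order`).  It contains the directional derivative of `h_y` at `1`, which is
  sublinear but not linear where `f` has a kink.  The Hahn-Banach theorem in a weighted `L²(Q)`
  replaces it by a linear functional, that is, by a measurable selection `b(y)` of subgradients of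
  `h_y` at `1` (`IsOptimalDensity.exists_subgradient`).
* So `log r + β₁ Δ + β₂ b` is orthogonal to all such `φ r`, and hence it depends on `x` only
  (`ae_exists_forall_ae_eq_of_orthogonal`).  This is the Gibbs form.
* Subgradients of `h_y` at `1` are exactly the numbers `f(s) - s ξ` with a subgradient `ξ` of `f` at
  `s` if `s > 0`, and equal `f(0)` if `s = 0` (`isSubgradient_of_persp`, `perceptionPenalty_eq`).

Given the Gibbs form, the objective of the Poisson functional representation is an increasing
function of the regularized distance as soon as all arrival times are positive
(`isMinOn_pfrObjective_iff`).
-/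

noncomputable section

namespace RDP

open InformationTheory

/-! ### One-sided derivatives of a convex function at `1` -/

section Convex

variable {h : ℝ → ℝ}

/-- The left derivative at `1`. -/
def leftSlope (h : ℝ → ℝ) : ℝ := derivWithin h (Set.Iio 1) 1

/-- The right derivative at `1`. -/
def rightSlope (h : ℝ → ℝ) : ℝ := derivWithin h (Set.Ioi 1) 1

/-- The sum of the absolute values of the slopes of the secants of `h` over `[1/2, 1]` and
`[1, 3/2]`.  For convex `h` this is a Lipschitz constant at `1` on `[1/2, 3/2]`. -/
def secantBound (h : ℝ → ℝ) : ℝ := |2 * (h 1 - h (1 / 2))| + |2 * (h (3 / 2) - h 1)|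

lemma secantBound_nonneg (h : ℝ → ℝ) : 0 ≤ secantBound h := by
  unfold secantBound; positivity

lemma one_mem_interior_Ioi : (1 : ℝ) ∈ interior (Set.Ioi (0 : ℝ)) := by simp

lemma leftSlope_le_rightSlope (hh : ConvexOn ℝ (Set.Ioi 0) h) : leftSlope h ≤ rightSlope h :=
  hh.leftDeriv_le_rightDeriv_of_mem_interior one_mem_interior_Ioi

lemma add_rightSlope_mul_le (hh : ConvexOn ℝ (Set.Ioi 0) h) {q : ℝ} (hq : 1 < q) :
    h 1 + rightSlope h * (q - 1) ≤ h q := by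
  have h1 := hh.rightDeriv_le_slope_of_mem_interior one_mem_interior_Ioi
    (show q ∈ Set.Ioi (0 : ℝ) from lt_trans one_pos hq) hq
  rw [slope_def_field, le_div_iff₀ (by linarith)] at h1
  unfold rightSlope
  linarith

lemma add_leftSlope_mul_le (hh : ConvexOn ℝ (Set.Ioi 0) h) {q : ℝ} (hq0 : 0 < q) (hq : q < 1) :
    h 1 + leftSlope h * (q - 1) ≤ h q := by
  have h1 := hh.slope_le_leftDeriv_of_mem_interior (show q ∈ Set.Ioi (0 : ℝ) from hq0)
    one_mem_interior_Ioi hq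
  rw [slope_def_field, div_le_iff₀ (by linarith)] at h1
  unfold leftSlope
  linarith

/-- Every number between the one-sided derivatives is a subgradient. -/
lemma add_mul_le_of_mem_Icc (hh : ConvexOn ℝ (Set.Ioi 0) h) {b q : ℝ}
    (hb : leftSlope h ≤ b) (hb' : b ≤ rightSlope h) (hq : 0 < q) :
    h 1 + b * (q - 1) ≤ h q := by
  rcases lt_trichotomy q 1 with h1 | rfl | h1
  · have := add_leftSlope_mul_le hh hq h1
    nlinarith
  · simp
  · have := add_rightSlope_mul_le hh h1
    nlinarith

lemma abs_rightSlope_le (hh : ConvexOn ℝ (Set.Ioi 0) h) : |rightSlope h| ≤ secantBound h := by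
  have h1 := add_rightSlope_mul_le hh (q := 3 / 2) (by norm_num)
  have h2 := add_leftSlope_mul_le hh (q := 1 / 2) (by norm_num) (by norm_num)
  have h3 := leftSlope_le_rightSlope hh
  have h4 := neg_abs_le (2 * (h 1 - h (1 / 2)))
  have h5 := le_abs_self (2 * (h (3 / 2) - h 1))
  have h6 := abs_nonneg (2 * (h 1 - h (1 / 2)))
  have h7 := abs_nonneg (2 * (h (3 / 2) - h 1))
  rw [abs_le, secantBound]
  constructor <;> linarith

lemma abs_leftSlope_le (hh : ConvexOn ℝ (Set.Ioi 0) h) : |leftSlope h| ≤ secantBound h := by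
  have h1 := add_rightSlope_mul_le hh (q := 3 / 2) (by norm_num)
  have h2 := add_leftSlope_mul_le hh (q := 1 / 2) (by norm_num) (by norm_num)
  have h3 := leftSlope_le_rightSlope hh
  have h4 := neg_abs_le (2 * (h 1 - h (1 / 2)))
  have h5 := le_abs_self (2 * (h (3 / 2) - h 1))
  have h6 := abs_nonneg (2 * (h 1 - h (1 / 2)))
  have h7 := abs_nonneg (2 * (h (3 / 2) - h 1))
  rw [abs_le, secantBound]
  constructor <;> linarith

lemma abs_sub_le_secantBound_mul (hh : ConvexOn ℝ (Set.Ioi 0) h) {q : ℝ} (hq : |q - 1| ≤ 1 / 2) :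
    |h q - h 1| ≤ secantBound h * |q - 1| := by
  have h4 := neg_abs_le (2 * (h 1 - h (1 / 2)))
  have h4' := le_abs_self (2 * (h 1 - h (1 / 2)))
  have h5 := le_abs_self (2 * (h (3 / 2) - h 1))
  have h5' := neg_abs_le (2 * (h (3 / 2) - h 1))
  have h6 := abs_nonneg (2 * (h 1 - h (1 / 2)))
  have h7 := abs_nonneg (2 * (h (3 / 2) - h 1))
  have hr := abs_le.1 (abs_rightSlope_le hh)
  have hl := abs_le.1 (abs_leftSlope_le hh)
  obtain ⟨ha, hb⟩ := abs_le.1 hq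
  rcases lt_trichotomy q 1 with h1 | rfl | h1
  · have hs := add_leftSlope_mul_le hh (q := q) (by linarith) h1
    -- `q` lies between `1/2` and `1`, with weights `2 (1 - q)` and `2 q - 1`
    have hc := hh.2 (show (1 / 2 : ℝ) ∈ Set.Ioi 0 by norm_num) (show (1 : ℝ) ∈ Set.Ioi 0 by norm_num)
      (show 0 ≤ 2 * (1 - q) by linarith) (show 0 ≤ 2 * q - 1 by linarith) (by ring)
    simp only [smul_eq_mul] at hc
    rw [show 2 * (1 - q) * (1 / 2) + (2 * q - 1) * 1 = q by ring] at hc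
    rw [abs_of_neg (by linarith : q - 1 < 0), abs_le]
    unfold secantBound at *
    constructor <;> nlinarith
  · simp
  · have hs := add_rightSlope_mul_le hh (q := q) h1
    have hc := hh.2 (show (3 / 2 : ℝ) ∈ Set.Ioi 0 by norm_num) (show (1 : ℝ) ∈ Set.Ioi 0 by norm_num)
      (show 0 ≤ 2 * (q - 1) by linarith) (show 0 ≤ 3 - 2 * q by linarith) (by ring)
    simp only [smul_eq_mul] at hc
    rw [show 2 * (q - 1) * (3 / 2) + (3 - 2 * q) * 1 = q by ring] at hc
    rw [abs_of_pos (by linarith : 0 < q - 1), abs_le]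
    unfold secantBound at *
    constructor <;> nlinarith

/-- The directional derivative of a convex function at `1`. -/
def dirDeriv (h : ℝ → ℝ) (u : ℝ) : ℝ := max (u * rightSlope h) (u * leftSlope h)

lemma abs_dirDeriv_le (hh : ConvexOn ℝ (Set.Ioi 0) h) (u : ℝ) :
    |dirDeriv h u| ≤ |u| * secantBound h := by
  refine (abs_max_le_max_abs_abs).trans (max_le ?_ ?_) <;> rw [abs_mul] <;> gcongr
  exacts [abs_rightSlope_le hh, abs_leftSlope_le hh]

lemma dirDeriv_one (hh : ConvexOn ℝ (Set.Ioi 0) h) : dirDeriv h 1 = rightSlope h := by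
  simp [dirDeriv, leftSlope_le_rightSlope hh]

lemma dirDeriv_neg_one (hh : ConvexOn ℝ (Set.Ioi 0) h) : dirDeriv h (-1) = -leftSlope h := by
  simp [dirDeriv, leftSlope_le_rightSlope hh]

lemma dirDeriv_smul (h : ℝ → ℝ) {c : ℝ} (hc : 0 ≤ c) (u : ℝ) :
    dirDeriv h (c * u) = c * dirDeriv h u := by
  simp [dirDeriv, mul_max_of_nonneg _ _ hc, mul_assoc]

lemma dirDeriv_add_le (h : ℝ → ℝ) (u v : ℝ) :
    dirDeriv h (u + v) ≤ dirDeriv h u + dirDeriv h v := by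
  unfold dirDeriv
  rw [add_mul, add_mul]
  exact max_add_add_le_max_add_max

lemma tendsto_dirDeriv (hh : ConvexOn ℝ (Set.Ioi 0) h) (u : ℝ) {t : ℕ → ℝ}
    (ht0 : ∀ n, 0 < t n) (ht : Tendsto t atTop (𝓝 0)) :
    Tendsto (fun n => (h (1 + t n * u) - h 1) / t n) atTop (𝓝 (dirDeriv h u)) := by
  have hle := leftSlope_le_rightSlope hh
  have hlim : Tendsto (fun n => 1 + t n * u) atTop (𝓝 1) := by
    simpa using (ht.mul_const u).const_add 1
  rcases lt_trichotomy u 0 with hu | rfl | hu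
  · have hd : dirDeriv h u = u * leftSlope h :=
      max_eq_right (mul_le_mul_of_nonpos_left hle hu.le)
    have h1 := (hasDerivWithinAt_iff_tendsto_slope' (by simp)).1
      (hh.hasDerivWithinAt_leftDeriv_of_mem_interior one_mem_interior_Ioi)
    have h2 : Tendsto (fun n => 1 + t n * u) atTop (𝓝[<] 1) :=
      tendsto_nhdsWithin_iff.2 ⟨hlim, Eventually.of_forall fun n => by
        have := mul_neg_of_pos_of_neg (ht0 n) hu
        simpa using this⟩
    rw [hd]
    refine ((h1.comp h2).const_mul u).congr fun n => ?_
    have := (ht0 n).ne'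
    have := hu.ne
    simp only [Function.comp, slope_def_field, add_sub_cancel_left]
    field_simp
  · simp [dirDeriv]
  · have hd : dirDeriv h u = u * rightSlope h :=
      max_eq_left (mul_le_mul_of_nonneg_left hle hu.le)
    have h1 := (hasDerivWithinAt_iff_tendsto_slope' (by simp)).1
      (hh.hasDerivWithinAt_rightDeriv_of_mem_interior one_mem_interior_Ioi)
    have h2 : Tendsto (fun n => 1 + t n * u) atTop (𝓝[>] 1) :=
      tendsto_nhdsWithin_iff.2 ⟨hlim, Eventually.of_forall fun n => by
        have := mul_pos (ht0 n) hu
        simpa using this⟩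
    rw [hd]
    refine ((h1.comp h2).const_mul u).congr fun n => ?_
    have := (ht0 n).ne'
    have := hu.ne'
    simp only [Function.comp, slope_def_field, add_sub_cancel_left]
    field_simp

section Measurability

variable {Y : Type*} [MeasurableSpace Y] {h : Y → ℝ → ℝ}

lemma measurable_secantBound (hm : ∀ q : Y → ℝ, Measurable q → Measurable fun y => h y (q y)) :
    Measurable fun y => secantBound (h y) := by
  have h1 := hm _ (measurable_const (a := (1 : ℝ)))
  have h2 := hm _ (measurable_const (a := (1 / 2 : ℝ)))
  have h3 := hm _ (measurable_const (a := (3 / 2 : ℝ)))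
  exact (measurable_const.mul (h1.sub h2)).abs.add (measurable_const.mul (h3.sub h1)).abs

lemma measurable_dirDeriv_const (hh : ∀ y, ConvexOn ℝ (Set.Ioi 0) (h y))
    (hm : ∀ q : Y → ℝ, Measurable q → Measurable fun y => h y (q y)) (u : ℝ) :
    Measurable fun y => dirDeriv (h y) u := by
  refine measurable_of_tendsto_metrizable
    (f := fun (n : ℕ) y => (h y (1 + 1 / ((n : ℝ) + 1) * u) - h y 1) / (1 / ((n : ℝ) + 1)))
    (fun n => ?_) (tendsto_pi_nhds.2 fun y => ?_)
  · exact ((hm _ measurable_const).sub (hm _ measurable_const)).div_const _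
  · exact tendsto_dirDeriv (hh y) u (fun n => by positivity) tendsto_one_div_add_atTop_nhds_zero_nat

lemma measurable_rightSlope (hh : ∀ y, ConvexOn ℝ (Set.Ioi 0) (h y))
    (hm : ∀ q : Y → ℝ, Measurable q → Measurable fun y => h y (q y)) :
    Measurable fun y => rightSlope (h y) := by
  simpa only [dirDeriv_one (hh _)] using measurable_dirDeriv_const hh hm 1

lemma measurable_leftSlope (hh : ∀ y, ConvexOn ℝ (Set.Ioi 0) (h y))
    (hm : ∀ q : Y → ℝ, Measurable q → Measurable fun y => h y (q y)) :
    Measurable fun y => leftSlope (h y) := by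
  have := (measurable_dirDeriv_const hh hm (-1)).neg
  simp only [dirDeriv_neg_one (hh _)] at this
  convert this using 1
  ext y
  simp

end Measurability

end Convex

/-! ### Conditional densities and the first-order condition -/

section Variational

variable {X Y : Type*} [MeasurableSpace X] [MeasurableSpace Y]

/-- `ρ(x, ·)` is a probability density with respect to `Q` for every `x`. -/
structure IsCondDensity (Q : Measure Y) (ρ : X × Y → ℝ) : Prop where
  measurable : Measurable ρ
  nonneg : ∀ z, 0 ≤ ρ z
  integrable : ∀ x, Integrable (fun y => ρ (x, y)) Q
  integral_eq_one : ∀ x, ∫ y, ρ (x, y) ∂Q = 1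

/-- `r` is the conditional density of a channel with input law `P` and output law `Q`, and no other
conditional density `ρ`, whose output law has a density `q` close to `1`, has a smaller value of
`∫ klFun ρ + β₁ ∫ Δ ρ + β₂ ∫ h(y, q(y)) Q(dy)`. -/
structure IsOptimalDensity (P : Measure X) (Q : Measure Y) (Δ : X × Y → ℝ) (h : Y → ℝ → ℝ)
    (β₁ β₂ : ℝ) (r : X × Y → ℝ) : Prop extends IsCondDensity Q r where
  marginal : ∀ᵐ y ∂Q, ∫ x, r (x, y) ∂P = 1
  integrable_klFun : Integrable (fun z => klFun (r z)) (P.prod Q)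
  integrable_cost : Integrable (fun z => Δ z * r z) (P.prod Q)
  le : ∀ (ρ : X × Y → ℝ) (q : Y → ℝ), IsCondDensity Q ρ →
    Integrable (fun z => klFun (ρ z)) (P.prod Q) → Integrable (fun z => Δ z * ρ z) (P.prod Q) →
    Measurable q → (∀ᵐ y ∂Q, ∫ x, ρ (x, y) ∂P = q y) → (∀ᵐ y ∂Q, |q y - 1| ≤ 1 / 2) →
    Integrable (fun y => h y (q y) - h y 1) Q →
    0 ≤ ∫ z, (klFun (ρ z) - klFun (r z)) ∂(P.prod Q)
      + β₁ * ∫ z, (Δ z * ρ z - Δ z * r z) ∂(P.prod Q) + β₂ * ∫ y, (h y (q y) - h y 1) ∂Q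

lemma IsCondDensity.integrable_prod {P : Measure X} [IsProbabilityMeasure P] {Q : Measure Y}
    [IsProbabilityMeasure Q] {ρ : X × Y → ℝ} (hρ : IsCondDensity Q ρ) :
    Integrable ρ (P.prod Q) := by
  refine (integrable_prod_iff hρ.measurable.aestronglyMeasurable).2
    ⟨ae_of_all _ hρ.integrable, ?_⟩
  simp [Real.norm_eq_abs, abs_of_nonneg (hρ.nonneg _), hρ.integral_eq_one]

/-- The density with respect to `Q` of the output law of the signed conditional density `φ r`. -/
def outputDensity (P : Measure X) (r φ : X × Y → ℝ) (y : Y) : ℝ :=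
  ∫ x, φ (x, y) * r (x, y) ∂P

lemma measurable_outputDensity {P : Measure X} [IsProbabilityMeasure P] {r φ : X × Y → ℝ}
    (hr : Measurable r) (hφ : Measurable φ) : Measurable (outputDensity P r φ) :=
  ((hφ.mul hr).stronglyMeasurable.integral_prod_left').measurable

lemma integral_outputDensity_mul {P : Measure X} [IsProbabilityMeasure P] {Q : Measure Y}
    [IsProbabilityMeasure Q] {r φ : X × Y → ℝ} {b : Y → ℝ}
    (hi : Integrable (fun z => b z.2 * (φ z * r z)) (P.prod Q)) :
    ∫ y, b y * outputDensity P r φ y ∂Q = ∫ z, b z.2 * (φ z * r z) ∂(P.prod Q) := by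
  rw [integral_prod_symm _ hi]
  simp_rw [outputDensity, integral_const_mul]

/-- The derivative of the information and of the expected cost `β₁ Δ` with respect to the joint
density.  At an optimal density it is the sum of a function of `x` and a function of `y`. -/
def logCost (Δ : X × Y → ℝ) (β₁ : ℝ) (r : X × Y → ℝ) (z : X × Y) : ℝ :=
  Real.log (r z) + β₁ * Δ z

lemma klFun_mul_one_add_le {a u : ℝ} (ha : 0 ≤ a) (hu : -1 < u) :
    klFun (a * (1 + u)) - klFun a ≤ u * (a * Real.log a) + a * u ^ 2 := by
  rcases ha.eq_or_lt with rfl | ha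
  · simp
  have h1 : 0 < 1 + u := by linarith
  have h2 := Real.log_le_sub_one_of_pos h1
  rw [klFun, klFun, Real.log_mul ha.ne' h1.ne']
  have h3 : a * (1 + u) * Real.log (1 + u) ≤ a * (1 + u) * u :=
    mul_le_mul_of_nonneg_left (by linarith) (by positivity)
  nlinarith

lemma IsOptimalDensity.ae_integrable_left {P : Measure X} {Q : Measure Y} {Δ : X × Y → ℝ}
    {h : Y → ℝ → ℝ} {β₁ β₂ : ℝ} {r : X × Y → ℝ} (hr : IsOptimalDensity P Q Δ h β₁ β₂ r) :
    ∀ᵐ y ∂Q, Integrable (fun x => r (x, y)) P := by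
  filter_upwards [hr.marginal] with y hy
  by_contra hn
  rw [integral_undef hn] at hy
  exact zero_ne_one hy

lemma IsOptimalDensity.ae_abs_outputDensity_le {P : Measure X} {Q : Measure Y} {Δ : X × Y → ℝ}
    {h : Y → ℝ → ℝ} {β₁ β₂ : ℝ} {r φ : X × Y → ℝ} {M : ℝ} (hr : IsOptimalDensity P Q Δ h β₁ β₂ r)
    (hM : ∀ z, |φ z| ≤ M) : ∀ᵐ y ∂Q, |outputDensity P r φ y| ≤ M := by
  filter_upwards [hr.ae_integrable_left, hr.marginal] with y hy hy1
  calc |outputDensity P r φ y| ≤ ∫ x, M * r (x, y) ∂P := by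
        rw [outputDensity, ← Real.norm_eq_abs]
        refine norm_integral_le_of_norm_le (hy.const_mul M) (ae_of_all _ fun x => ?_)
        rw [norm_mul, Real.norm_eq_abs, Real.norm_eq_abs, abs_of_nonneg (hr.nonneg _)]
        exact mul_le_mul_of_nonneg_right (hM _) (hr.nonneg _)
    _ = M := by rw [integral_const_mul, hy1, mul_one]

namespace IsOptimalDensity

variable {P : Measure X} [IsProbabilityMeasure P] {Q : Measure Y} [IsProbabilityMeasure Q]
  {Δ : X × Y → ℝ} {h : Y → ℝ → ℝ} {β₁ β₂ : ℝ} {r φ : X × Y → ℝ} {M : ℝ}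

lemma integrable_mul (hr : IsOptimalDensity P Q Δ h β₁ β₂ r) (hφ : Measurable φ)
    (hM : ∀ z, |φ z| ≤ M) : Integrable (fun z => φ z * r z) (P.prod Q) :=
  hr.toIsCondDensity.integrable_prod.bdd_mul hφ.aestronglyMeasurable (ae_of_all _ hM)

lemma integrable_mul_log (hr : IsOptimalDensity P Q Δ h β₁ β₂ r) :
    Integrable (fun z => r z * Real.log (r z)) (P.prod Q) := by
  refine ((hr.integrable_klFun.add hr.toIsCondDensity.integrable_prod).sub
    (integrable_const 1)).congr (ae_of_all _ fun z => ?_)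
  simp [klFun]

/-- The first-order optimality condition, for perturbations `r (1 + t φ)`. -/
lemma first_order (hr : IsOptimalDensity P Q Δ h β₁ β₂ r)
    (hh : ∀ y, ConvexOn ℝ (Set.Ioi 0) (h y))
    (hm : ∀ q : Y → ℝ, Measurable q → Measurable fun y => h y (q y))
    (hφ : Measurable φ) (hM : ∀ z, |φ z| ≤ M) (hC : ∀ z, φ z ≠ 0 → secantBound (h z.2) ≤ M)
    (h0 : ∀ x, ∫ y, φ (x, y) * r (x, y) ∂Q = 0) :
    0 ≤ ∫ z, φ z * r z * logCost Δ β₁ r z ∂(P.prod Q)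
      + β₂ * ∫ y, dirDeriv (h y) (outputDensity P r φ y) ∂Q := by
  set ψ := outputDensity P r φ with hψ
  have hψm : Measurable ψ := measurable_outputDensity hr.measurable hφ
  obtain ⟨x₀⟩ : Nonempty X := by
    by_contra hX
    rw [not_nonempty_iff] at hX
    exact IsProbabilityMeasure.ne_zero P (Measure.eq_zero_of_isEmpty P)
  obtain ⟨y₀⟩ : Nonempty Y := by
    by_contra hX
    rw [not_nonempty_iff] at hX
    exact IsProbabilityMeasure.ne_zero Q (Measure.eq_zero_of_isEmpty Q)
  have hM0 : 0 ≤ M := (abs_nonneg _).trans (hM (x₀, y₀))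
  have hψM : ∀ᵐ y ∂Q, |ψ y| ≤ M := hr.ae_abs_outputDensity_le hM
  have hψC : ∀ y, M < secantBound (h y) → ψ y = 0 := by
    intro y hy
    have : ∀ x, φ (x, y) = 0 := fun x => by
      by_contra hne
      exact absurd (hC _ hne) (not_le.2 hy)
    simp [hψ, outputDensity, this]
  set t : ℕ → ℝ := fun n => 1 / (2 * (M + 1)) * (1 / ((n : ℝ) + 1)) with ht
  have ht0 : ∀ n, 0 < t n := fun n => by positivity
  have htlim : Tendsto t atTop (𝓝 0) := by
    simpa only [mul_zero] using
      (tendsto_one_div_add_atTop_nhds_zero_nat (𝕜 := ℝ)).const_mul (1 / (2 * (M + 1)))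
  have htM : ∀ n, t n * M ≤ 1 / 2 := fun n => by
    have h1 : 1 / ((n : ℝ) + 1) ≤ 1 := by
      rw [div_le_one (by positivity)]; linarith [Nat.cast_nonneg (α := ℝ) n]
    have h2 : t n ≤ 1 / (2 * (M + 1)) :=
      mul_le_of_le_one_right (by positivity) h1
    calc t n * M ≤ 1 / (2 * (M + 1)) * M := by gcongr
      _ ≤ 1 / 2 := by rw [div_mul_eq_mul_div, div_le_div_iff₀ (by positivity) (by norm_num)]; linarith
  have htφ : ∀ n z, |t n * φ z| ≤ 1 / 2 := fun n z => by
    rw [abs_mul, abs_of_pos (ht0 n)]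
    exact (mul_le_mul_of_nonneg_left (hM z) (ht0 n).le).trans (htM n)
  have hbd : ∀ n, ∀ᵐ y ∂Q, ‖(h y (1 + t n * ψ y) - h y 1) / t n‖ ≤ M * M := fun n => by
    filter_upwards [hψM] with y hy
    by_cases hCy : M < secantBound (h y)
    · simp [hψC y hCy, mul_self_nonneg]
    push Not at hCy
    have h1 : |t n * ψ y| ≤ 1 / 2 := by
      rw [abs_mul, abs_of_pos (ht0 n)]
      exact (mul_le_mul_of_nonneg_left hy (ht0 n).le).trans (htM n)
    have h2 := abs_sub_le_secantBound_mul (hh y) (q := 1 + t n * ψ y) (by simpa using h1)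
    rw [Real.norm_eq_abs, abs_div, abs_of_pos (ht0 n), div_le_iff₀ (ht0 n)]
    refine h2.trans ?_
    rw [add_sub_cancel_left, abs_mul, abs_of_pos (ht0 n)]
    calc secantBound (h y) * (t n * |ψ y|) ≤ M * (t n * M) := by
          have := (ht0 n).le
          gcongr
      _ = M * M * t n := by ring
  have hqm : ∀ n, Measurable fun y => 1 + t n * ψ y := fun n =>
    measurable_const.add (measurable_const.mul hψm)
  have hhm : ∀ n, Measurable fun y => (h y (1 + t n * ψ y) - h y 1) / t n := fun n =>
    ((hm _ (hqm n)).sub (hm _ measurable_const)).div_const _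
  have hlog : Integrable (fun z => φ z * (r z * Real.log (r z))) (P.prod Q) :=
    hr.integrable_mul_log.bdd_mul hφ.aestronglyMeasurable (ae_of_all _ hM)
  have hcost : Integrable (fun z => φ z * (Δ z * r z)) (P.prod Q) :=
    hr.integrable_cost.bdd_mul hφ.aestronglyMeasurable (ae_of_all _ hM)
  have hsq : Integrable (fun z => φ z ^ 2 * r z) (P.prod Q) :=
    hr.integrable_mul (φ := fun z => φ z ^ 2) (M := M ^ 2) (hφ.pow_const 2) fun z => by
      rw [abs_pow]; exact pow_le_pow_left₀ (abs_nonneg _) (hM z) 2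
  have hA : ∫ z, φ z * r z * logCost Δ β₁ r z ∂(P.prod Q)
      = ∫ z, φ z * (r z * Real.log (r z)) ∂(P.prod Q)
        + β₁ * ∫ z, φ z * (Δ z * r z) ∂(P.prod Q) := by
    rw [← integral_const_mul, ← integral_add hlog (hcost.const_mul _)]
    refine integral_congr_ae (ae_of_all _ fun z => ?_)
    simp only [logCost]; ring
  -- the inequality for a fixed step size `t n`, divided by `t n`
  have key : ∀ n, 0 ≤ ∫ z, φ z * r z * logCost Δ β₁ r z ∂(P.prod Q)
      + t n * ∫ z, φ z ^ 2 * r z ∂(P.prod Q)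
      + β₂ * ∫ y, (h y (1 + t n * ψ y) - h y 1) / t n ∂Q := by
    intro n
    have htn := ht0 n
    set ρ : X × Y → ℝ := fun z => r z * (1 + t n * φ z) with hρ
    have hpos : ∀ z, 0 ≤ 1 + t n * φ z := fun z => by linarith [(abs_le.1 (htφ n z)).1]
    have hφrx : ∀ x, Integrable (fun y => φ (x, y) * r (x, y)) Q := fun x =>
      (hr.integrable x).bdd_mul (hφ.comp measurable_prodMk_left).aestronglyMeasurable
        (ae_of_all _ fun y => hM (x, y))
    have hρd : IsCondDensity Q ρ := by
      refine ⟨hr.measurable.mul (measurable_const.add (measurable_const.mul hφ)),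
        fun z => mul_nonneg (hr.nonneg z) (hpos z), fun x => ?_, fun x => ?_⟩
      · refine ((hr.integrable x).add ((hφrx x).const_mul (t n))).congr (ae_of_all _ fun y => ?_)
        simp only [hρ, Pi.add_apply]; ring
      · calc ∫ y, ρ (x, y) ∂Q = ∫ y, (r (x, y) + t n * (φ (x, y) * r (x, y))) ∂Q := by
              refine integral_congr_ae (ae_of_all _ fun y => ?_)
              simp only [hρ]; ring
          _ = 1 := by
              rw [integral_add (hr.integrable x) ((hφrx x).const_mul _), integral_const_mul,
                h0 x, hr.integral_eq_one x]
              ring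
    have hkl_le : ∀ z, klFun (ρ z) - klFun (r z)
        ≤ t n * (φ z * (r z * Real.log (r z))) + t n ^ 2 * (φ z ^ 2 * r z) := fun z => by
      have := klFun_mul_one_add_le (a := r z) (u := t n * φ z) (hr.nonneg z)
        (by linarith [(abs_le.1 (htφ n z)).1])
      calc _ ≤ _ := this
        _ = _ := by ring
    have hub : Integrable (fun z => t n * (φ z * (r z * Real.log (r z)))
        + t n ^ 2 * (φ z ^ 2 * r z)) (P.prod Q) := (hlog.const_mul _).add (hsq.const_mul _)
    have hklρ : Integrable (fun z => klFun (ρ z)) (P.prod Q) := by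
      refine (hr.integrable_klFun.add hub).mono'
        (measurable_klFun.comp hρd.measurable).aestronglyMeasurable (ae_of_all _ fun z => ?_)
      rw [Real.norm_eq_abs, abs_of_nonneg (klFun_nonneg (hρd.nonneg z))]
      have := hkl_le z
      simp only [Pi.add_apply]
      linarith
    have hΔρ : Integrable (fun z => Δ z * ρ z) (P.prod Q) := by
      refine (hr.integrable_cost.add (hcost.const_mul (t n))).congr (ae_of_all _ fun z => ?_)
      simp only [hρ, Pi.add_apply]; ring
    have hmarg : ∀ᵐ y ∂Q, ∫ x, ρ (x, y) ∂P = 1 + t n * ψ y := by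
      filter_upwards [hr.ae_integrable_left, hr.marginal] with y hy hy1
      have hφy : Integrable (fun x => φ (x, y) * r (x, y)) P :=
        hy.bdd_mul (hφ.comp measurable_prodMk_right).aestronglyMeasurable
          (ae_of_all _ fun x => hM (x, y))
      calc ∫ x, ρ (x, y) ∂P = ∫ x, (r (x, y) + t n * (φ (x, y) * r (x, y))) ∂P := by
            refine integral_congr_ae (ae_of_all _ fun y => ?_)
            simp only [hρ]; ring
        _ = 1 + t n * ψ y := by
            rw [integral_add hy (hφy.const_mul _), integral_const_mul, hy1]
            rfl
    have hhi : Integrable (fun y => (h y (1 + t n * ψ y) - h y 1) / t n) Q :=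
      (integrable_const (M * M)).mono' (hhm n).aestronglyMeasurable (hbd n)
    have hhi' : Integrable (fun y => h y (1 + t n * ψ y) - h y 1) Q :=
      (hhi.const_mul (t n)).congr (ae_of_all _ fun y => by field_simp)
    have hmain := hr.le ρ (fun y => 1 + t n * ψ y) hρd hklρ hΔρ (hqm n) hmarg (by
      filter_upwards [hψM] with y hy
      rw [add_sub_cancel_left, abs_mul, abs_of_pos htn]
      exact (mul_le_mul_of_nonneg_left hy htn.le).trans (htM n)) hhi'
    have h1 : ∫ z, (klFun (ρ z) - klFun (r z)) ∂(P.prod Q)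
        ≤ t n * ∫ z, φ z * (r z * Real.log (r z)) ∂(P.prod Q)
          + t n ^ 2 * ∫ z, φ z ^ 2 * r z ∂(P.prod Q) := by
      rw [← integral_const_mul, ← integral_const_mul,
        ← integral_add (hlog.const_mul _) (hsq.const_mul _)]
      exact integral_mono (hklρ.sub hr.integrable_klFun) hub hkl_le
    have h2 : ∫ z, (Δ z * ρ z - Δ z * r z) ∂(P.prod Q)
        = t n * ∫ z, φ z * (Δ z * r z) ∂(P.prod Q) := by
      rw [← integral_const_mul]
      refine integral_congr_ae (ae_of_all _ fun z => ?_)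
      simp only [hρ]; ring
    have h3 : ∫ y, (h y (1 + t n * ψ y) - h y 1) ∂Q
        = t n * ∫ y, (h y (1 + t n * ψ y) - h y 1) / t n ∂Q := by
      rw [← integral_const_mul]
      refine integral_congr_ae (ae_of_all _ fun z => ?_)
      field_simp
    rw [h2, h3] at hmain
    rw [hA]
    refine nonneg_of_mul_nonneg_right (b := _) ?_ htn
    nlinarith
  have hlim : Tendsto (fun n => ∫ y, (h y (1 + t n * ψ y) - h y 1) / t n ∂Q) atTop
      (𝓝 (∫ y, dirDeriv (h y) (ψ y) ∂Q)) :=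
    tendsto_integral_of_dominated_convergence (fun _ => M * M)
      (fun n => (hhm n).aestronglyMeasurable) (integrable_const _) hbd
      (ae_of_all _ fun y => tendsto_dirDeriv (hh y) (ψ y) ht0 htlim)
  have hlim' := ((tendsto_const_nhds (x := ∫ z, φ z * r z * logCost Δ β₁ r z ∂(P.prod Q))).add
    (htlim.mul_const (∫ z, φ z ^ 2 * r z ∂(P.prod Q)))).add (hlim.const_mul β₂)
  rw [zero_mul, add_zero] at hlim'
  exact ge_of_tendsto' hlim' key

end IsOptimalDensity

end Variational

/-! ### Positivity of optimal densities -/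

section Positivity

variable {X Y : Type*} [MeasurableSpace X] [MeasurableSpace Y]

lemma klFun_mul_sub_one_le {t k : ℝ} (ht : 0 < t) (hk : 0 ≤ k) (hk1 : k ≤ 1) :
    klFun (t * k) - 1 ≤ t * Real.log t * k := by
  rcases hk.eq_or_lt with rfl | hk
  · simp [klFun]
  rw [klFun, Real.log_mul ht.ne' hk.ne']
  have h1 := Real.log_nonpos hk.le hk1
  have h2 : t * k * Real.log k ≤ 0 := mul_nonpos_of_nonneg_of_nonpos (by positivity) h1
  have h3 : 0 < t * k := by positivity
  nlinarith

lemma klFun_one_sub_mul_le {a θ : ℝ} (ha : 0 ≤ a) (hθ : 0 ≤ θ) (hθ1 : θ ≤ 1) :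
    klFun ((1 - θ) * a) ≤ klFun a + θ := by
  have h1 := convexOn_klFun.2 (show a ∈ Set.Ici (0 : ℝ) from ha)
    (Set.mem_Ici.2 (le_refl (0 : ℝ))) (sub_nonneg.2 hθ1) hθ (by ring)
  simp only [smul_eq_mul, mul_zero, add_zero, klFun_zero, mul_one] at h1
  have h2 := mul_nonneg hθ (klFun_nonneg ha)
  linarith

namespace IsOptimalDensity

variable {P : Measure X} [IsProbabilityMeasure P] {Q : Measure Y} [IsProbabilityMeasure Q]
  {Δ : X × Y → ℝ} {h : Y → ℝ → ℝ} {β₁ β₂ : ℝ} {r : X × Y → ℝ}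

/-- Shifting a little mass to a set where `r` vanishes would change the information by an amount
of order `t log t` and the costs only by an amount of order `t`; so such a set, once truncated to
where the costs are bounded, is null. -/
lemma ae_integral_indicator_eq_zero (hr : IsOptimalDensity P Q Δ h β₁ β₂ r) (hΔ : Measurable Δ)
    (hΔ0 : ∀ z, 0 ≤ Δ z) (hβ₁ : 0 ≤ β₁) (hβ₂ : 0 ≤ β₂) (hh : ∀ y, ConvexOn ℝ (Set.Ioi 0) (h y))
    (hm : ∀ q : Y → ℝ, Measurable q → Measurable fun y => h y (q y)) {M : ℝ} (hM0 : 0 ≤ M) :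
    ∀ᵐ z ∂(P.prod Q), r z = 0 → secantBound (h z.2) ≤ M → Δ z ≤ M →
      ∫ y, {y : Y | secantBound (h y) ≤ M}.indicator (fun y => r (z.1, y)) y ∂Q = 0 := by
  set N : Set (X × Y) := {z | r z = 0 ∧ secantBound (h z.2) ≤ M ∧ Δ z ≤ M} with hN
  set G : Set Y := {y | secantBound (h y) ≤ M} with hG
  have hCm := measurable_secantBound hm
  have hrm := hr.measurable
  have hNm : MeasurableSet N := by
    refine (measurableSet_eq_fun hrm measurable_const).inter
      ((measurableSet_le (hCm.comp measurable_snd) measurable_const).inter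
        (measurableSet_le hΔ measurable_const))
  have hGm : MeasurableSet G := measurableSet_le hCm measurable_const
  -- `k x` is the mass that the channel gives to `G`, `n x` the output mass of the section of `N`
  set k : X → ℝ := fun x => ∫ y, G.indicator (fun y => r (x, y)) y ∂Q with hk
  set n : X → ℝ := fun x => ∫ y, N.indicator 1 (x, y) ∂Q with hn
  have hkm : Measurable k := by
    have : Measurable fun z : X × Y => G.indicator (fun y => r (z.1, y)) z.2 := by
      have h1 : (fun z : X × Y => G.indicator (fun y => r (z.1, y)) z.2)
          = (Prod.snd ⁻¹' G).indicator r := by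
        ext z; simp only [Set.indicator, Set.mem_preimage]
      rw [h1]; exact hrm.indicator (measurable_snd hGm)
    exact this.stronglyMeasurable.integral_prod_right'.measurable
  have h1N : Measurable (N.indicator (1 : X × Y → ℝ)) := measurable_one.indicator hNm
  have hnm : Measurable n := h1N.stronglyMeasurable.integral_prod_right'.measurable
  have hNle : ∀ z, 0 ≤ N.indicator (1 : X × Y → ℝ) z ∧ N.indicator (1 : X × Y → ℝ) z ≤ 1 :=
    fun z => ⟨Set.indicator_nonneg (fun _ _ => zero_le_one) _,
      Set.indicator_le' (fun _ _ => le_rfl) (fun _ _ => zero_le_one) _⟩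
  have hGi : ∀ x, Integrable (fun y => G.indicator (fun y => r (x, y)) y) Q :=
    fun x => (hr.integrable x).indicator hGm
  have hNi : ∀ x, Integrable (fun y => N.indicator (1 : X × Y → ℝ) (x, y)) Q := fun x =>
    (integrable_const (1 : ℝ)).mono' (h1N.comp measurable_prodMk_left).aestronglyMeasurable
      (ae_of_all _ fun y => by
        rw [Real.norm_eq_abs, abs_of_nonneg (hNle _).1]; exact (hNle _).2)
  have hk0 : ∀ x, 0 ≤ k x := fun x =>
    integral_nonneg fun y => Set.indicator_nonneg (fun _ _ => hr.nonneg _) _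
  have hk1 : ∀ x, k x ≤ 1 := fun x => by
    rw [← hr.integral_eq_one x]
    exact integral_mono (hGi x) (hr.integrable x)
      fun y => Set.indicator_le_self' (fun _ _ => hr.nonneg _) y
  have hn0 : ∀ x, 0 ≤ n x := fun x => integral_nonneg fun y => (hNle _).1
  have hn1 : ∀ x, n x ≤ 1 := fun x => by
    calc n x ≤ ∫ _, (1 : ℝ) ∂Q := integral_mono (hNi x) (integrable_const _) fun y => (hNle _).2
      _ = 1 := by simp
  have hNk : Integrable (fun z : X × Y => N.indicator 1 z * k z.1) (P.prod Q) :=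
    (integrable_const (1 : ℝ)).mono' (h1N.mul (hkm.comp measurable_fst)).aestronglyMeasurable
      (ae_of_all _ fun z => by
        rw [Real.norm_eq_abs, abs_of_nonneg (mul_nonneg (hNle _).1 (hk0 _))]
        exact mul_le_one₀ (hNle _).2 (hk0 _) (hk1 _))
  set c := ∫ z, N.indicator 1 z * k z.1 ∂(P.prod Q) with hc
  have hc0 : 0 ≤ c := integral_nonneg fun z => mul_nonneg (hNle _).1 (hk0 _)
  suffices hc_eq : c = 0 by
    have h1 := (integral_eq_zero_iff_of_nonneg
      (fun z => mul_nonneg (hNle _).1 (hk0 _)) hNk).1 hc_eq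
    filter_upwards [h1] with z hz h0 hC hM
    have hzN : z ∈ N := ⟨h0, hC, hM⟩
    simpa [hzN] using hz
  by_contra hne
  have hcpos : 0 < c := lt_of_le_of_ne hc0 (Ne.symm hne)
  -- the perturbation moves the mass `t n k` from `G` to the section of `N`
  set g : X × Y → ℝ := fun z => (Prod.snd ⁻¹' G).indicator 1 z with hg
  have hgm : Measurable g := measurable_one.indicator (measurable_snd hGm)
  have hgle : ∀ z, 0 ≤ g z ∧ g z ≤ 1 :=
    fun z => ⟨Set.indicator_nonneg (fun _ _ => zero_le_one) _,
      Set.indicator_le' (fun _ _ => le_rfl) (fun _ _ => zero_le_one) _⟩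
  set η : X × Y → ℝ := fun z => N.indicator 1 z * k z.1 - n z.1 * g z * r z with hη
  have hηm : Measurable η := (h1N.mul (hkm.comp measurable_fst)).sub
    (((hnm.comp measurable_fst).mul hgm).mul hrm)
  have hng : ∀ z : X × Y, 0 ≤ n z.1 * g z ∧ n z.1 * g z ≤ 1 := fun z =>
    ⟨mul_nonneg (hn0 _) (hgle _).1, mul_le_one₀ (hn1 _) (hgle _).1 (hgle _).2⟩
  have hη_of_mem : ∀ z ∈ N, η z = k z.1 := fun z hz => by
    have h0 : r z = 0 := hz.1
    simp [hη, hz, h0]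
  have hη_of_notMem : ∀ z ∉ N, η z = -(n z.1 * g z * r z) := fun z hz => by
    simp [hη, hz]
  set K : ℝ := 1 + β₁ * M + β₂ * M with hK
  have hK0 : 0 ≤ K := by positivity
  set t : ℝ := Real.exp (-(K / c) - 1) with ht
  have ht0 : 0 < t := Real.exp_pos _
  have ht2 : t ≤ 1 / 2 := by
    have h1 : t ≤ Real.exp (-1) := by
      apply Real.exp_le_exp.2
      have : 0 ≤ K / c := by positivity
      linarith
    have h2 : Real.exp (-1) ≤ 1 / 2 := by
      rw [Real.exp_neg, one_div]
      refine inv_anti₀ (by norm_num) ?_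
      have := Real.add_one_le_exp 1
      linarith
    exact h1.trans h2
  have hlogt : Real.log t = -(K / c) - 1 := Real.log_exp _
  set ρ : X × Y → ℝ := fun z => r z + t * η z with hρ
  have hρN : ∀ z ∈ N, ρ z = t * k z.1 := fun z hz => by
    have h0 : r z = 0 := hz.1
    simp only [hρ, hη_of_mem z hz, h0, zero_add]
  have hρN' : ∀ z ∉ N, ρ z = (1 - t * (n z.1 * g z)) * r z := fun z hz => by
    simp only [hρ, hη_of_notMem z hz]; ring
  have hgr : ∀ x, Integrable (fun y => g (x, y) * r (x, y)) Q := fun x =>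
    (hGi x).congr (ae_of_all _ fun y => by
      by_cases hy : y ∈ G <;> simp [hg, Set.indicator, hy])
  have hgr1 : ∀ x, ∫ y, g (x, y) * r (x, y) ∂Q = k x := fun x => by
    refine integral_congr_ae (ae_of_all _ fun y => ?_)
    by_cases hy : y ∈ G <;> simp [hg, Set.indicator, hy]
  have hηx : ∀ x, Integrable (fun y => η (x, y)) Q := fun x => by
    refine (((hNi x).mul_const (k x)).sub ((hgr x).const_mul (n x))).congr
      (ae_of_all _ fun y => ?_)
    simp only [hη, Pi.sub_apply]; ring
  have hη0 : ∀ x, ∫ y, η (x, y) ∂Q = 0 := fun x => by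
    calc ∫ y, η (x, y) ∂Q
        = ∫ y, (N.indicator 1 (x, y) * k x - n x * (g (x, y) * r (x, y))) ∂Q := by
          refine integral_congr_ae (ae_of_all _ fun y => ?_)
          simp only [hη]; ring
      _ = n x * k x - n x * k x := by
          rw [integral_sub ((hNi x).mul_const _) ((hgr x).const_mul _), integral_mul_const,
            integral_const_mul, hgr1 x]
      _ = 0 := sub_self _
  have hρd : IsCondDensity Q ρ := by
    refine ⟨hrm.add (measurable_const.mul hηm), fun z => ?_, fun x => ?_, fun x => ?_⟩
    · by_cases hz : z ∈ N
      · rw [hρN z hz]; exact mul_nonneg ht0.le (hk0 _)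
      · rw [hρN' z hz]
        refine mul_nonneg ?_ (hr.nonneg z)
        have := mul_le_one₀ (ht2.trans (by norm_num)) (hng z).1 (hng z).2
        linarith
    · exact (hr.integrable x).add ((hηx x).const_mul t)
    · simp only [hρ]
      rw [integral_add (hr.integrable x) ((hηx x).const_mul t), integral_const_mul, hη0 x,
        hr.integral_eq_one x]
      ring
  have hkl_le : ∀ z, klFun (ρ z) - klFun (r z)
      ≤ t + t * Real.log t * (N.indicator 1 z * k z.1) := fun z => by
    by_cases hz : z ∈ N
    · have h0 : r z = 0 := hz.1
      rw [hρN z hz, h0, klFun_zero]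
      have := klFun_mul_sub_one_le ht0 (hk0 z.1) (hk1 z.1)
      simp only [hz, Set.indicator_of_mem, Pi.one_apply, one_mul]
      linarith
    · rw [hρN' z hz]
      have h1 : t * (n z.1 * g z) ≤ t := mul_le_of_le_one_right ht0.le (hng z).2
      have := klFun_one_sub_mul_le (hr.nonneg z) (mul_nonneg ht0.le (hng z).1)
        (h1.trans (ht2.trans (by norm_num)))
      simp only [hz, not_false_eq_true, Set.indicator_of_notMem, zero_mul, mul_zero, add_zero]
      linarith
  have hub : Integrable (fun z => t + t * Real.log t * (N.indicator 1 z * k z.1)) (P.prod Q) :=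
    (integrable_const t).add (hNk.const_mul _)
  have hklρ : Integrable (fun z => klFun (ρ z)) (P.prod Q) := by
    refine (hr.integrable_klFun.add hub).mono'
      (measurable_klFun.comp hρd.measurable).aestronglyMeasurable (ae_of_all _ fun z => ?_)
    rw [Real.norm_eq_abs, abs_of_nonneg (klFun_nonneg (hρd.nonneg z))]
    have := hkl_le z
    simp only [Pi.add_apply]
    linarith
  have hΔ_le : ∀ z, Δ z * ρ z - Δ z * r z ≤ t * M := fun z => by
    by_cases hz : z ∈ N
    · have h0 : r z = 0 := hz.1
      rw [hρN z hz, h0]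
      have h1 : Δ z ≤ M := hz.2.2
      have h2 : Δ z * (t * k z.1) ≤ M * (t * 1) := by
        have := hΔ0 z
        have := hk0 z.1
        have := hk1 z.1
        gcongr
      linarith
    · rw [hρN' z hz]
      have : 0 ≤ Δ z * (t * (n z.1 * g z) * r z) :=
        mul_nonneg (hΔ0 z) (mul_nonneg (mul_nonneg ht0.le (hng z).1) (hr.nonneg z))
      have : 0 ≤ t * M := by positivity
      nlinarith
  have hΔρ : Integrable (fun z => Δ z * ρ z) (P.prod Q) := by
    refine (hr.integrable_cost.add (integrable_const (t * M))).mono'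
      (hΔ.mul hρd.measurable).aestronglyMeasurable (ae_of_all _ fun z => ?_)
    rw [Real.norm_eq_abs, abs_of_nonneg (mul_nonneg (hΔ0 z) (hρd.nonneg z))]
    have := hΔ_le z
    simp only [Pi.add_apply]
    linarith
  set ψ : Y → ℝ := fun y => ∫ x, η (x, y) ∂P with hψ
  have hψm : Measurable ψ := hηm.stronglyMeasurable.integral_prod_left'.measurable
  have hNkle : ∀ z : X × Y, 0 ≤ N.indicator 1 z * k z.1 ∧ N.indicator 1 z * k z.1 ≤ 1 := fun z =>
    ⟨mul_nonneg (hNle _).1 (hk0 _), mul_le_one₀ (hNle _).2 (hk0 _) (hk1 _)⟩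
  have hηy : ∀ᵐ y ∂Q, Integrable (fun x => η (x, y)) P := by
    filter_upwards [hr.ae_integrable_left] with y hy
    refine ((integrable_const (1 : ℝ)).add hy).mono'
      (hηm.comp measurable_prodMk_right).aestronglyMeasurable (ae_of_all _ fun x => ?_)
    have h1 := hNkle (x, y)
    have h2 := mul_nonneg (hng (x, y)).1 (hr.nonneg (x, y))
    have h3 := mul_le_of_le_one_left (hr.nonneg (x, y)) (hng (x, y)).2
    simp only [Pi.add_apply, hη, Real.norm_eq_abs, abs_le]
    constructor <;> linarith [h1.1, h1.2]
  have hψ1 : ∀ᵐ y ∂Q, |ψ y| ≤ 1 := by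
    filter_upwards [hr.ae_integrable_left, hr.marginal, hηy] with y hy hy1 hyη
    rw [abs_le]
    constructor
    · calc (-1 : ℝ) = ∫ x, -r (x, y) ∂P := by rw [integral_neg, hy1]
        _ ≤ ψ y := by
          refine integral_mono hy.neg hyη fun x => ?_
          have h1 := hNkle (x, y)
          have h3 := mul_le_of_le_one_left (hr.nonneg (x, y)) (hng (x, y)).2
          simp only [hη]
          linarith [h1.1]
    · calc ψ y ≤ ∫ _, (1 : ℝ) ∂P := by
            refine integral_mono hyη (integrable_const _) fun x => ?_
            have h1 := hNkle (x, y)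
            have h2 := mul_nonneg (hng (x, y)).1 (hr.nonneg (x, y))
            simp only [hη]
            linarith [h1.2]
        _ = 1 := by simp
  have hψG : ∀ y ∉ G, ψ y = 0 := fun y hy => by
    have : ∀ x, η (x, y) = 0 := fun x => by
      have h1 : (x, y) ∉ N := fun hz => hy hz.2.1
      have h2 : g (x, y) = 0 := by simp [hg, Set.indicator, hy]
      rw [hη_of_notMem _ h1, h2]; ring
    simp [hψ, this]
  have htψ : ∀ᵐ y ∂Q, |t * ψ y| ≤ t := by
    filter_upwards [hψ1] with y hy
    rw [abs_mul, abs_of_pos ht0]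
    exact mul_le_of_le_one_right ht0.le hy
  have hh_le : ∀ᵐ y ∂Q, |h y (1 + t * ψ y) - h y 1| ≤ t * M := by
    filter_upwards [htψ] with y hy
    by_cases hyG : y ∈ G
    · have h2 := abs_sub_le_secantBound_mul (hh y) (q := 1 + t * ψ y)
        (by simpa using hy.trans ht2)
      rw [add_sub_cancel_left] at h2
      calc _ ≤ _ := h2
        _ ≤ M * t := mul_le_mul hyG hy (abs_nonneg _) hM0
        _ = t * M := mul_comm _ _
    · simp only [hψG y hyG, mul_zero, add_zero, sub_self, abs_zero]
      positivity
  have hqm : Measurable fun y => 1 + t * ψ y := measurable_const.add (measurable_const.mul hψm)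
  have hhi : Integrable (fun y => h y (1 + t * ψ y) - h y 1) Q :=
    (integrable_const (t * M)).mono'
      ((hm _ hqm).sub (hm _ measurable_const)).aestronglyMeasurable hh_le
  have hmarg : ∀ᵐ y ∂Q, ∫ x, ρ (x, y) ∂P = 1 + t * ψ y := by
    filter_upwards [hr.ae_integrable_left, hr.marginal, hηy] with y hy hy1 hyη
    simp only [hρ]
    rw [integral_add hy (hyη.const_mul _), integral_const_mul, hy1]
  have hmain := hr.le ρ (fun y => 1 + t * ψ y) hρd hklρ hΔρ hqm hmarg (by
    filter_upwards [htψ] with y hy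
    rw [add_sub_cancel_left]
    exact hy.trans ht2) hhi
  have h1 : ∫ z, (klFun (ρ z) - klFun (r z)) ∂(P.prod Q) ≤ t + t * Real.log t * c := by
    calc _ ≤ ∫ z, (t + t * Real.log t * (N.indicator 1 z * k z.1)) ∂(P.prod Q) :=
          integral_mono (hklρ.sub hr.integrable_klFun) hub hkl_le
      _ = _ := by
          rw [integral_add (integrable_const t) (hNk.const_mul _), integral_const_mul]
          simp [hc]
  have h2 : ∫ z, (Δ z * ρ z - Δ z * r z) ∂(P.prod Q) ≤ t * M := by
    calc _ ≤ ∫ _, t * M ∂(P.prod Q) :=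
          integral_mono (hΔρ.sub hr.integrable_cost) (integrable_const _) hΔ_le
      _ = t * M := by simp
  have h3 : ∫ y, (h y (1 + t * ψ y) - h y 1) ∂Q ≤ t * M := by
    calc _ ≤ ∫ _, t * M ∂Q := by
          refine integral_mono_ae hhi (integrable_const _) ?_
          filter_upwards [hh_le] with y hy using (le_abs_self _).trans hy
      _ = t * M := by simp
  have h4 : t * Real.log t * c = -(t * K) - t * c := by
    rw [hlogt]; field_simp
  have h5 := mul_le_mul_of_nonneg_left h2 hβ₁
  have h6 := mul_le_mul_of_nonneg_left h3 hβ₂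
  have h7 : 0 < t * c := mul_pos ht0 hcpos
  rw [hK] at h4
  nlinarith

/-- An optimal density is positive. -/
lemma ae_pos (hr : IsOptimalDensity P Q Δ h β₁ β₂ r) (hΔ : Measurable Δ)
    (hΔ0 : ∀ z, 0 ≤ Δ z) (hβ₁ : 0 ≤ β₁) (hβ₂ : 0 ≤ β₂) (hh : ∀ y, ConvexOn ℝ (Set.Ioi 0) (h y))
    (hm : ∀ q : Y → ℝ, Measurable q → Measurable fun y => h y (q y)) :
    ∀ᵐ z ∂(P.prod Q), 0 < r z := by
  have h1 : ∀ᵐ z ∂(P.prod Q), ∀ m : ℕ, r z = 0 → secantBound (h z.2) ≤ m → Δ z ≤ m →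
      ∫ y, {y : Y | secantBound (h y) ≤ m}.indicator (fun y => r (z.1, y)) y ∂Q = 0 :=
    ae_all_iff.2 fun m =>
      hr.ae_integral_indicator_eq_zero hΔ hΔ0 hβ₁ hβ₂ hh hm (Nat.cast_nonneg m)
  filter_upwards [h1] with z hz
  refine (hr.nonneg z).lt_of_ne fun h0 => ?_
  have hGm : ∀ m : ℕ, MeasurableSet {y : Y | secantBound (h y) ≤ m} := fun m =>
    measurableSet_le (measurable_secantBound hm) measurable_const
  obtain ⟨m₀, hm₀⟩ := exists_nat_ge (max (secantBound (h z.2)) (Δ z))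
  -- the integrals of `r z.1` over `{secantBound ≤ m}` tend to `1`
  have h2 : Tendsto (fun m : ℕ =>
      ∫ y, {y : Y | secantBound (h y) ≤ m}.indicator (fun y => r (z.1, y)) y ∂Q) atTop
      (𝓝 (∫ y, r (z.1, y) ∂Q)) := by
    refine tendsto_integral_of_dominated_convergence (fun y => r (z.1, y))
      (fun m => ((hr.integrable z.1).indicator (hGm m)).aestronglyMeasurable) (hr.integrable z.1)
      (fun m => ae_of_all _ fun y => ?_) (ae_of_all _ fun y => ?_)
    · rw [Real.norm_eq_abs, abs_of_nonneg (Set.indicator_nonneg (fun _ _ => hr.nonneg _) _)]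
      exact Set.indicator_le_self' (fun _ _ => hr.nonneg _) y
    · obtain ⟨m₁, hm₁⟩ := exists_nat_ge (secantBound (h y))
      refine tendsto_const_nhds.congr' ?_
      filter_upwards [eventually_ge_atTop m₁] with m hm
      have : secantBound (h y) ≤ m := hm₁.trans (Nat.cast_le.2 hm)
      simp [this]
  rw [hr.integral_eq_one] at h2
  have h3 : Tendsto (fun m : ℕ =>
      ∫ y, {y : Y | secantBound (h y) ≤ m}.indicator (fun y => r (z.1, y)) y ∂Q) atTop (𝓝 0) := by
    refine tendsto_const_nhds.congr' ?_
    filter_upwards [eventually_ge_atTop m₀] with m hm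
    have hmm : max (secantBound (h z.2)) (Δ z) ≤ m := hm₀.trans (Nat.cast_le.2 hm)
    exact (hz m h0.symm ((le_max_left _ _).trans hmm) ((le_max_right _ _).trans hmm)).symm
  exact one_ne_zero (tendsto_nhds_unique h2 h3)

end IsOptimalDensity

end Positivity

/-! ### Selection of a subgradient by the Hahn-Banach theorem -/

section Multiplier

/-- A linear functional that is dominated by a bounded sublinear functional `N` through a linear map
`T` into a Hilbert space is represented by a vector whose inner products are dominated by `N`. -/
lemma exists_inner_le_of_le_sublinear {V H : Type*} [AddCommGroup V] [Module ℝ V]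
    [NormedAddCommGroup H] [InnerProductSpace ℝ H] [CompleteSpace H] (T : V →ₗ[ℝ] H)
    (l : V →ₗ[ℝ] ℝ) (N : H → ℝ) (N_hom : ∀ c : ℝ, 0 < c → ∀ v, N (c • v) = c * N v)
    (N_add : ∀ v w, N (v + w) ≤ N v + N w) {C : ℝ} (N_le : ∀ v, N v ≤ C * ‖v‖)
    (hle : ∀ φ, l φ ≤ N (T φ)) :
    ∃ b : H, (∀ v, inner ℝ b v ≤ N v) ∧ ∀ φ, l φ = inner ℝ b (T φ) := by
  have hN0 : N 0 ≤ 0 := by simpa using N_le 0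
  have hker : LinearMap.ker T ≤ LinearMap.ker l := by
    intro φ hφ
    rw [LinearMap.mem_ker] at hφ ⊢
    have h1 := hle φ
    have h2 := hle (-φ)
    rw [map_neg, map_neg, hφ, neg_zero] at h2
    rw [hφ] at h1
    linarith
  set g : LinearMap.range T →ₗ[ℝ] ℝ :=
    (LinearMap.ker T).liftQ l hker ∘ₗ T.quotKerEquivRange.symm.toLinearMap with hg
  have hgT : ∀ φ, g ⟨T φ, LinearMap.mem_range_self T φ⟩ = l φ := fun φ => by
    simp only [hg, LinearMap.comp_apply, LinearEquiv.coe_coe]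
    rw [LinearMap.quotKerEquivRange_symm_apply_image T φ (LinearMap.mem_range_self T φ)]
    simp
  obtain ⟨G, hG1, hG2⟩ := exists_extension_of_le_sublinear ⟨LinearMap.range T, g⟩ N N_hom N_add (by
    rintro ⟨_, φ, rfl⟩
    exact (hgT φ).trans_le (hle φ))
  have hGb : ∀ v, ‖G v‖ ≤ C * ‖v‖ := fun v => by
    rw [Real.norm_eq_abs, abs_le]
    have h1 := (hG2 (-v)).trans (N_le (-v))
    rw [map_neg, norm_neg] at h1
    exact ⟨by linarith, (hG2 v).trans (N_le v)⟩
  set G' : H →L[ℝ] ℝ := G.mkContinuous C hGb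
  have hin : ∀ v, inner ℝ ((InnerProductSpace.toDual ℝ H).symm G') v = G v := fun v => by
    rw [InnerProductSpace.toDual_symm_apply]; rfl
  refine ⟨(InnerProductSpace.toDual ℝ H).symm G', fun v => (hin v).trans_le (hG2 v), fun φ => ?_⟩
  rw [hin, ← hgT φ]
  exact (hG1 ⟨T φ, LinearMap.mem_range_self T φ⟩).symm

variable {X Y : Type*} [MeasurableSpace X] [MeasurableSpace Y]

/-- The bounded directions `φ` in which the conditional density `r` may be multiplied by `1 + t φ`:
they do not change the total mass, and vanish where `c` or `F` is large. -/
def directions (Q : Measure Y) (r F : X × Y → ℝ) (c : Y → ℝ) (hr : ∀ x, Integrable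
    (fun y => r (x, y)) Q) : Submodule ℝ (X × Y → ℝ) where
  carrier := {φ | Measurable φ ∧
    (∃ M, 0 ≤ M ∧ (∀ z, |φ z| ≤ M) ∧ ∀ z, φ z ≠ 0 → c z.2 ≤ M ∧ |F z| ≤ M) ∧
    ∀ x, ∫ y, φ (x, y) * r (x, y) ∂Q = 0}
  zero_mem' := ⟨measurable_zero, ⟨0, le_rfl, by simp, by simp⟩, by simp⟩
  add_mem' := by
    rintro φ₁ φ₂ ⟨h1, ⟨M₁, hM₁, hb₁, hs₁⟩, hi₁⟩ ⟨h2, ⟨M₂, hM₂, hb₂, hs₂⟩, hi₂⟩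
    refine ⟨h1.add h2, ⟨M₁ + M₂, by positivity,
      fun z => (abs_add_le _ _).trans (add_le_add (hb₁ z) (hb₂ z)), fun z hz => ?_⟩, fun x => ?_⟩
    · by_cases h : φ₁ z = 0
      · have h' : φ₂ z ≠ 0 := fun h' => hz (by simp [h, h'])
        exact ⟨by linarith [(hs₂ z h').1], by linarith [(hs₂ z h').2]⟩
      · exact ⟨by linarith [(hs₁ z h).1], by linarith [(hs₁ z h).2]⟩
    · have e1 : Integrable (fun y => φ₁ (x, y) * r (x, y)) Q := (hr x).bdd_mul
        (h1.comp measurable_prodMk_left).aestronglyMeasurable (ae_of_all _ fun y => hb₁ (x, y))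
      have e2 : Integrable (fun y => φ₂ (x, y) * r (x, y)) Q := (hr x).bdd_mul
        (h2.comp measurable_prodMk_left).aestronglyMeasurable (ae_of_all _ fun y => hb₂ (x, y))
      simp only [Pi.add_apply, add_mul]
      rw [integral_add e1 e2, hi₁ x, hi₂ x, add_zero]
  smul_mem' := by
    rintro a φ ⟨h1, ⟨M, hM, hb, hs⟩, hi⟩
    refine ⟨h1.const_smul a, ⟨|a| * M + M, by positivity, fun z => ?_, fun z hz => ?_⟩, fun x => ?_⟩
    · simp only [Pi.smul_apply, smul_eq_mul, abs_mul]
      have := mul_le_mul_of_nonneg_left (hb z) (abs_nonneg a)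
      linarith
    · have h' : φ z ≠ 0 := fun h' => hz (by simp [h'])
      have : 0 ≤ |a| * M := by positivity
      exact ⟨by linarith [(hs z h').1], by linarith [(hs z h').2]⟩
    · simp only [Pi.smul_apply, smul_eq_mul, mul_assoc]
      rw [integral_const_mul, hi x, mul_zero]

namespace IsOptimalDensity

variable {P : Measure X} [IsProbabilityMeasure P] {Q : Measure Y} [IsProbabilityMeasure Q]
  {Δ : X × Y → ℝ} {h : Y → ℝ → ℝ} {β₁ β₂ : ℝ} {r : X × Y → ℝ}

/-- The first-order condition selects a measurable subgradient `b` of `h y` at `1` against which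
`logCost + β₂ b` is orthogonal to all directions. -/
lemma exists_subgradient (hr : IsOptimalDensity P Q Δ h β₁ β₂ r) (hΔ : Measurable Δ)
    (hβ₂ : 0 < β₂) (hh : ∀ y, ConvexOn ℝ (Set.Ioi 0) (h y))
    (hm : ∀ q : Y → ℝ, Measurable q → Measurable fun y => h y (q y)) :
    ∃ b : Y → ℝ, Measurable b ∧ (∀ y, leftSlope (h y) ≤ b y ∧ b y ≤ rightSlope (h y)) ∧
      ∀ φ ∈ directions Q r (logCost Δ β₁ r) (fun y => secantBound (h y)) hr.integrable,
        ∫ z, φ z * r z * (logCost Δ β₁ r z + β₂ * b z.2) ∂(P.prod Q) = 0 := by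
  set F := logCost Δ β₁ r with hF
  have hFm : Measurable F :=
    (Real.measurable_log.comp hr.measurable).add (measurable_const.mul hΔ)
  set C : Y → ℝ := fun y => secantBound (h y) with hCdef
  have hC0 : ∀ y, 0 ≤ C y := fun y => secantBound_nonneg _
  have hCm : Measurable C := measurable_secantBound hm
  have hgr : Measurable fun y => rightSlope (h y) := measurable_rightSlope hh hm
  have hgl : Measurable fun y => leftSlope (h y) := measurable_leftSlope hh hm
  set V := directions Q r F C hr.integrable with hV
  -- the weight `1 + C` makes the directional derivative a bounded functional on `L²(Q)`
  set w : Y → ℝ := fun y => 1 + C y with hw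
  have hw1 : ∀ y, 1 ≤ w y := fun y => by simp only [hw]; linarith [hC0 y]
  have hw0 : ∀ y, 0 < w y := fun y => one_pos.trans_le (hw1 y)
  have hwm : Measurable w := measurable_const.add hCm
  have hdm : ∀ v : Y → ℝ, Measurable v → Measurable fun y => dirDeriv (h y) (v y) := fun v hv =>
    (hv.mul hgr).max (hv.mul hgl)
  have hd_le : ∀ (v : ℝ) (y : Y), |dirDeriv (h y) (v / w y)| ≤ |v| := fun v y => by
    refine (abs_dirDeriv_le (hh y) _).trans ?_
    rw [abs_div, abs_of_pos (hw0 y), div_mul_eq_mul_div, div_le_iff₀ (hw0 y)]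
    exact mul_le_mul_of_nonneg_left (by simp only [hw, hCdef]; linarith) (abs_nonneg v)
  have hdi : ∀ v : Lp ℝ 2 Q, Integrable (fun y => dirDeriv (h y) (v y / w y)) Q := fun v => by
    have hv : Integrable v Q := (Lp.memLp v).integrable (by norm_num)
    refine hv.abs.mono' ?_ (ae_of_all _ fun y => hd_le _ y)
    have h1 : AEMeasurable (fun y => v y / w y) Q :=
      (Lp.aestronglyMeasurable v).aemeasurable.div hwm.aemeasurable
    exact ((h1.mul hgr.aemeasurable).max (h1.mul hgl.aemeasurable)).aestronglyMeasurable
  set N : Lp ℝ 2 Q → ℝ := fun v => ∫ y, dirDeriv (h y) (v y / w y) ∂Q with hN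
  have N_hom : ∀ c : ℝ, 0 < c → ∀ v, N (c • v) = c * N v := fun c hc v => by
    simp only [hN]
    rw [← integral_const_mul]
    refine integral_congr_ae ?_
    filter_upwards [Lp.coeFn_smul c v] with y hy
    rw [hy, Pi.smul_apply, smul_eq_mul, mul_div_assoc, dirDeriv_smul _ hc.le]
  have N_add : ∀ v v', N (v + v') ≤ N v + N v' := fun v v' => by
    simp only [hN]
    rw [← integral_add (hdi v) (hdi v')]
    refine integral_mono_ae (hdi _) ((hdi v).add (hdi v')) ?_
    filter_upwards [Lp.coeFn_add v v'] with y hy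
    rw [hy, Pi.add_apply, add_div]
    exact dirDeriv_add_le _ _ _
  have N_le : ∀ v, N v ≤ 1 * ‖v‖ := fun v => by
    have hv : Integrable v Q := (Lp.memLp v).integrable (by norm_num)
    calc N v ≤ ∫ y, ‖v y‖ ∂Q :=
          integral_mono (hdi v) hv.norm fun y => (le_abs_self _).trans (hd_le _ y)
      _ = (eLpNorm v 1 Q).toReal := by
          rw [integral_norm_eq_lintegral_enorm hv.aestronglyMeasurable, eLpNorm_one_eq_lintegral_enorm]
      _ ≤ (eLpNorm v 2 Q).toReal := by
          refine ENNReal.toReal_mono (Lp.eLpNorm_ne_top v) ?_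
          exact eLpNorm_le_eLpNorm_of_exponent_le (by norm_num) hv.aestronglyMeasurable
      _ = 1 * ‖v‖ := by rw [one_mul, Lp.norm_def]
  have hψm : ∀ φ : V, Measurable (outputDensity P r φ.1) := fun φ =>
    measurable_outputDensity hr.measurable φ.2.1
  have hTm : ∀ φ : V, MemLp (fun y => w y * outputDensity P r φ.1 y) 2 Q := fun φ => by
    obtain ⟨hφ, ⟨M, hM, hb, hs⟩, hi⟩ := φ.2
    refine MemLp.of_bound (hwm.mul (hψm φ)).aestronglyMeasurable ((1 + M) * M) ?_
    filter_upwards [hr.ae_abs_outputDensity_le hb] with y hy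
    by_cases hCy : C y ≤ M
    · rw [norm_mul, Real.norm_eq_abs, Real.norm_eq_abs, abs_of_pos (hw0 y)]
      exact mul_le_mul (by simp only [hw]; linarith) hy (abs_nonneg _) (by linarith)
    · have : ∀ x, φ.1 (x, y) = 0 := fun x => by
        by_contra hne
        exact hCy (hs _ hne).1
      simp only [outputDensity, this, zero_mul, integral_zero, mul_zero, norm_zero]
      positivity
  have hφi : ∀ φ : V, Integrable (fun z => φ.1 z * r z) (P.prod Q) := fun φ => by
    obtain ⟨hφ, ⟨M, hM, hb, hs⟩, hi⟩ := φ.2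
    exact hr.integrable_mul hφ hb
  -- multiplying by a function that is bounded where `C` and `F` are
  have hφFi : ∀ (φ : V) (G : X × Y → ℝ), Measurable G → (∀ z, |G z| ≤ C z.2 ∨ |G z| ≤ |F z|) →
      Integrable (fun z => G z * (φ.1 z * r z)) (P.prod Q) := fun φ G hG hGF => by
    obtain ⟨hφ, ⟨M, hM, hb, hs⟩, hi⟩ := φ.2
    have h1 := hr.integrable_mul (φ := fun z => G z * φ.1 z) (M := M * M) (hG.mul hφ) fun z => by
      by_cases hz : φ.1 z = 0
      · simp [hz, mul_self_nonneg]
      · rw [abs_mul]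
        have : |G z| ≤ M := (hGF z).elim (fun h => h.trans (hs z hz).1)
          (fun h => h.trans (hs z hz).2)
        exact mul_le_mul this (hb z) (abs_nonneg _) hM
    exact h1.congr (ae_of_all _ fun z => by ring)
  have hadd : ∀ φ₁ φ₂ : V, outputDensity P r (φ₁ + φ₂ : V).1 =ᵐ[Q]
      fun y => outputDensity P r φ₁.1 y + outputDensity P r φ₂.1 y := fun φ₁ φ₂ => by
    filter_upwards [(hφi φ₁).prod_left_ae, (hφi φ₂).prod_left_ae] with y h1 h2
    simp only [outputDensity]
    rw [← integral_add h1 h2]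
    refine integral_congr_ae (ae_of_all _ fun x => ?_)
    simp [add_mul]
  set T : V →ₗ[ℝ] Lp ℝ 2 Q :=
    { toFun := fun φ => (hTm φ).toLp
      map_add' := fun φ₁ φ₂ => by
        rw [← MemLp.toLp_add, MemLp.toLp_eq_toLp_iff]
        filter_upwards [hadd φ₁ φ₂] with y hy
        rw [hy, Pi.add_apply, mul_add]
      map_smul' := fun a φ => by
        rw [RingHom.id_apply, ← MemLp.toLp_const_smul, MemLp.toLp_eq_toLp_iff]
        refine ae_of_all _ fun y => ?_
        simp only [outputDensity, Submodule.coe_smul, Pi.smul_apply, smul_eq_mul, mul_assoc]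
        rw [integral_const_mul]; ring } with hT
  have hTae : ∀ φ : V, T φ =ᵐ[Q] fun y => w y * outputDensity P r φ.1 y := fun φ =>
    (hTm φ).coeFn_toLp
  set l : V →ₗ[ℝ] ℝ :=
    { toFun := fun φ => -(1 / β₂) * ∫ z, F z * (φ.1 z * r z) ∂(P.prod Q)
      map_add' := fun φ₁ φ₂ => by
        rw [← mul_add, ← integral_add (hφFi φ₁ F hFm fun z => Or.inr le_rfl)
          (hφFi φ₂ F hFm fun z => Or.inr le_rfl)]
        congr 1
        refine integral_congr_ae (ae_of_all _ fun z => ?_)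
        simp only [Submodule.coe_add, Pi.add_apply]; ring
      map_smul' := fun a φ => by
        have : ∫ z, F z * ((a • φ : V).1 z * r z) ∂(P.prod Q)
            = a * ∫ z, F z * (φ.1 z * r z) ∂(P.prod Q) := by
          rw [← integral_const_mul]
          refine integral_congr_ae (ae_of_all _ fun z => ?_)
          simp only [Submodule.coe_smul, Pi.smul_apply, smul_eq_mul]; ring
        rw [this, RingHom.id_apply, smul_eq_mul]; ring } with hl
  have hle : ∀ φ, l φ ≤ N (T φ) := fun φ => by
    obtain ⟨hφ, ⟨M, hM, hb, hs⟩, hi⟩ := φ.2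
    have h1 := hr.first_order hh hm hφ hb (fun z hz => (hs z hz).1) hi
    have h2 : N (T φ) = ∫ y, dirDeriv (h y) (outputDensity P r φ.1 y) ∂Q := by
      refine integral_congr_ae ?_
      filter_upwards [hTae φ] with y hy
      rw [hy, mul_div_cancel_left₀ _ (hw0 y).ne']
    have h3 : ∫ z, F z * (φ.1 z * r z) ∂(P.prod Q)
        = ∫ z, φ.1 z * r z * F z ∂(P.prod Q) := by
      refine integral_congr_ae (ae_of_all _ fun z => ?_)
      simp only []; ring
    have h4 : l φ = -(1 / β₂) * ∫ z, φ.1 z * r z * F z ∂(P.prod Q) := by rw [← h3]; rfl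
    rw [h4, h2, neg_mul, one_div, neg_le_iff_add_nonneg, ← mul_le_mul_iff_right₀ hβ₂]
    rw [mul_zero, mul_add, mul_inv_cancel_left₀ hβ₂.ne']
    linarith
  obtain ⟨v, hv1, hv2⟩ := exists_inner_le_of_le_sublinear T l N N_hom N_add N_le hle
  have hvi : Integrable v Q := (Lp.memLp v).integrable (by norm_num)
  -- testing against indicators gives the pointwise bounds
  have hNind : ∀ (a : ℝ) (s : Set Y) (hs : MeasurableSet s),
      a * ∫ y in s, v y ∂Q ≤ ∫ y in s, dirDeriv (h y) a / w y ∂Q := fun a s hs => by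
    have h1 := hv1 (indicatorConstLp 2 hs (measure_ne_top Q s) a)
    rw [real_inner_comm, L2.inner_indicatorConstLp_eq_inner_setIntegral] at h1
    have h2 : N (indicatorConstLp 2 hs (measure_ne_top Q s) a)
        = ∫ y in s, dirDeriv (h y) a / w y ∂Q := by
      rw [← integral_indicator hs]
      refine integral_congr_ae ?_
      filter_upwards [indicatorConstLp_coeFn (p := 2) (hs := hs) (hμs := measure_ne_top Q s)
        (c := a)] with y hy
      rw [hy]
      by_cases hys : y ∈ s
      · rw [Set.indicator_of_mem hys, Set.indicator_of_mem hys, div_eq_inv_mul,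
          dirDeriv_smul _ (inv_nonneg.2 (hw0 y).le), div_eq_inv_mul]
      · simp [hys, dirDeriv]
    rw [h2] at h1
    simpa [mul_comm] using h1
  have hsl : ∀ a : ℝ, |a| ≤ 1 → Integrable (fun y => dirDeriv (h y) a / w y) Q := fun a ha => by
    refine (integrable_const (1 : ℝ)).mono'
      ((hdm _ measurable_const).div hwm).aestronglyMeasurable (ae_of_all _ fun y => ?_)
    have := hd_le a y
    rw [div_eq_inv_mul, dirDeriv_smul _ (inv_nonneg.2 (hw0 y).le)] at this
    rw [Real.norm_eq_abs, div_eq_inv_mul]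
    exact this.trans ha
  have hup : ∀ᵐ y ∂Q, v y ≤ rightSlope (h y) / w y := by
    refine ae_le_of_forall_setIntegral_le hvi ?_ fun s hs _ => ?_
    · simpa only [dirDeriv_one (hh _)] using hsl 1 (by simp)
    · simpa only [dirDeriv_one (hh _), one_mul] using hNind 1 s hs
  have hlo : ∀ᵐ y ∂Q, leftSlope (h y) / w y ≤ v y := by
    have hi : Integrable (fun y => leftSlope (h y) / w y) Q := by
      have := (hsl (-1) (by simp)).neg
      refine this.congr (ae_of_all _ fun y => ?_)
      simp [dirDeriv_neg_one (hh _), neg_div]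
    refine ae_le_of_forall_setIntegral_le hi hvi fun s hs _ => ?_
    have := hNind (-1) s hs
    simp only [dirDeriv_neg_one (hh _), neg_div, integral_neg] at this
    linarith
  -- a representative that lies between the one-sided derivatives everywhere
  set v' : Y → ℝ := (Lp.aestronglyMeasurable v).mk v with hv'
  have hv'm : Measurable v' := (Lp.aestronglyMeasurable v).stronglyMeasurable_mk.measurable
  have hv'ae : v =ᵐ[Q] v' := (Lp.aestronglyMeasurable v).ae_eq_mk
  set b : Y → ℝ := fun y => max (leftSlope (h y)) (min (rightSlope (h y)) (v' y * w y)) with hb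
  have hbm : Measurable b := hgl.max (hgr.min (hv'm.mul hwm))
  have hb_mem : ∀ y, leftSlope (h y) ≤ b y ∧ b y ≤ rightSlope (h y) := fun y =>
    ⟨le_max_left _ _, max_le (leftSlope_le_rightSlope (hh y)) (min_le_left _ _)⟩
  have hbae : ∀ᵐ y ∂Q, b y = v y * w y := by
    filter_upwards [hup, hlo, hv'ae] with y h1 h2 h3
    rw [le_div_iff₀ (hw0 y)] at h1
    rw [div_le_iff₀ (hw0 y)] at h2
    simp only [hb, ← h3]
    rw [min_eq_right h1, max_eq_right h2]
  refine ⟨b, hbm, hb_mem, fun φ hφ => ?_⟩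
  have hbC : ∀ y, |b y| ≤ C y := fun y => by
    have h1 := abs_le.1 (abs_rightSlope_le (hh y))
    have h2 := abs_le.1 (abs_leftSlope_le (hh y))
    exact abs_le.2 ⟨h2.1.trans (hb_mem y).1, (hb_mem y).2.trans h1.2⟩
  have hbi := hφFi ⟨φ, hφ⟩ (fun z => b z.2) (hbm.comp measurable_snd) fun z => Or.inl (hbC z.2)
  have hFi := hφFi ⟨φ, hφ⟩ F hFm fun z => Or.inr le_rfl
  have h1 : inner ℝ v (T ⟨φ, hφ⟩) = ∫ z, b z.2 * (φ z * r z) ∂(P.prod Q) := by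
    rw [← integral_outputDensity_mul hbi, L2.inner_def]
    refine integral_congr_ae ?_
    filter_upwards [hTae ⟨φ, hφ⟩, hbae] with y h1 h2
    rw [h1, h2]
    simp; ring
  have h2 := hv2 ⟨φ, hφ⟩
  rw [h1] at h2
  have h3 : -(1 / β₂) * ∫ z, F z * (φ z * r z) ∂(P.prod Q)
      = ∫ z, b z.2 * (φ z * r z) ∂(P.prod Q) := h2
  calc _ = ∫ z, (F z * (φ z * r z) + β₂ * (b z.2 * (φ z * r z))) ∂(P.prod Q) := by
        refine integral_congr_ae (ae_of_all _ fun z => ?_)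
        simp only []; ring
    _ = 0 := by
        rw [integral_add hFi (hbi.const_mul _), integral_const_mul, ← h3]
        field_simp
        ring

end IsOptimalDensity

end Multiplier

/-! ### The Gibbs form of optimal densities -/

section Constancy

variable {X Y : Type*} [MeasurableSpace X] [MeasurableSpace Y]

/-- If `T` is orthogonal to all directions, then `T (x, ·)` is almost surely constant: the direction
obtained by centring a truncation of `T` shows that its conditional variance vanishes. -/
lemma ae_exists_forall_ae_eq_of_orthogonal {P : Measure X} [IsProbabilityMeasure P] {Q : Measure Y}
    [IsProbabilityMeasure Q] {r F T : X × Y → ℝ} {c : Y → ℝ} {A : ℝ} (hr : IsCondDensity Q r)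
    (hpos : ∀ᵐ z ∂(P.prod Q), 0 < r z) (hF : Measurable F) (hT : Measurable T) (hc : Measurable c)
    (hTF : ∀ z, |T z| ≤ |F z| + A * c z.2) (hA : 0 ≤ A)
    (horth : ∀ φ ∈ directions Q r F c hr.integrable, ∫ z, φ z * r z * T z ∂(P.prod Q) = 0) :
    ∀ᵐ x ∂P, ∃ a, ∀ᵐ y ∂Q, 0 < r (x, y) ∧ T (x, y) = a := by
  set B : ℕ → Set (X × Y) := fun M => {z | c z.2 ≤ M ∧ |F z| ≤ M} with hB
  have hBm : ∀ M, MeasurableSet (B M) := fun M =>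
    (measurableSet_le (hc.comp measurable_snd) measurable_const).inter
      (measurableSet_le hF.abs measurable_const)
  have hBmono : ∀ {M M' : ℕ}, M ≤ M' → B M ⊆ B M' := fun {M M'} h z hz =>
    ⟨hz.1.trans (Nat.cast_le.2 h), hz.2.trans (Nat.cast_le.2 h)⟩
  have hBex : ∀ z, ∃ M, z ∈ B M := fun z => by
    obtain ⟨M, hM⟩ := exists_nat_ge (max (c z.2) |F z|)
    exact ⟨M, (le_max_left _ _).trans hM, (le_max_right _ _).trans hM⟩
  have hBT : ∀ M, ∀ z ∈ B M, |T z| ≤ M + A * M := fun M z hz =>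
    (hTF z).trans (add_le_add hz.2 (mul_le_mul_of_nonneg_left hz.1 hA))
  -- the mass `m₀` of `B M` under the channel, and the integral `m₁` of `T` over it
  set χ : ℕ → X × Y → ℝ := fun M => (B M).indicator 1 with hχ
  have hχm : ∀ M, Measurable (χ M) := fun M => measurable_one.indicator (hBm M)
  have hχle : ∀ M z, 0 ≤ χ M z ∧ χ M z ≤ 1 := fun M z =>
    ⟨Set.indicator_nonneg (fun _ _ => zero_le_one) _,
      Set.indicator_le' (fun _ _ => le_rfl) (fun _ _ => zero_le_one) _⟩
  have hχT : ∀ M z, |χ M z * T z| ≤ M + A * M := fun M z => by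
    by_cases hz : z ∈ B M
    · simpa [hχ, hz] using hBT M z hz
    · simp only [hχ, Set.indicator_of_notMem hz, zero_mul, abs_zero]; positivity
  set m₀ : ℕ → X → ℝ := fun M x => ∫ y, χ M (x, y) * r (x, y) ∂Q with hm₀
  set m₁ : ℕ → X → ℝ := fun M x => ∫ y, χ M (x, y) * T (x, y) * r (x, y) ∂Q with hm₁
  have hm₀m : ∀ M, Measurable (m₀ M) := fun M =>
    ((hχm M).mul hr.measurable).stronglyMeasurable.integral_prod_right'.measurable
  have hm₁m : ∀ M, Measurable (m₁ M) := fun M =>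
    (((hχm M).mul hT).mul hr.measurable).stronglyMeasurable.integral_prod_right'.measurable
  have hi₀ : ∀ M x, Integrable (fun y => χ M (x, y) * r (x, y)) Q := fun M x =>
    (hr.integrable x).bdd_mul ((hχm M).comp measurable_prodMk_left).aestronglyMeasurable
      (c := 1) (ae_of_all _ fun y => by
        rw [Real.norm_eq_abs, abs_of_nonneg (hχle M _).1]; exact (hχle M _).2)
  have hi₁ : ∀ M x, Integrable (fun y => χ M (x, y) * T (x, y) * r (x, y)) Q := fun M x =>
    (hr.integrable x).bdd_mul (((hχm M).mul hT).comp measurable_prodMk_left).aestronglyMeasurable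
      (ae_of_all _ fun y => hχT M (x, y))
  have hm₀0 : ∀ M x, 0 ≤ m₀ M x := fun M x =>
    integral_nonneg fun y => mul_nonneg (hχle M _).1 (hr.nonneg _)
  have hm₀1 : ∀ M x, m₀ M x ≤ 1 := fun M x => by
    rw [← hr.integral_eq_one x]
    exact integral_mono (hi₀ M x) (hr.integrable x)
      fun y => mul_le_of_le_one_left (hr.nonneg _) (hχle M _).2
  have hm₁b : ∀ (M : ℕ) x, |m₁ M x| ≤ M + A * M := fun M x => by
    calc |m₁ M x| ≤ ∫ y, (M + A * M) * r (x, y) ∂Q := by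
          rw [← Real.norm_eq_abs]
          refine norm_integral_le_of_norm_le ((hr.integrable x).const_mul _)
            (ae_of_all _ fun y => ?_)
          rw [norm_mul, Real.norm_eq_abs, Real.norm_eq_abs, abs_of_nonneg (hr.nonneg _)]
          exact mul_le_mul_of_nonneg_right (hχT M _) (hr.nonneg _)
      _ = M + A * M := by rw [integral_const_mul, hr.integral_eq_one, mul_one]
  set S : ℕ → X × Y → ℝ := fun M z => m₀ M z.1 * T z - m₁ M z.1 with hS
  have hSm : ∀ M, Measurable (S M) := fun M =>
    (((hm₀m M).comp measurable_fst).mul hT).sub ((hm₁m M).comp measurable_fst)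
  have hχS : ∀ M z, |χ M z * S M z| ≤ 2 * (M + A * M) := fun M z => by
    have h1 : χ M z * S M z = m₀ M z.1 * (χ M z * T z) - χ M z * m₁ M z.1 := by
      simp only [hS]; ring
    rw [h1]
    refine (abs_sub _ _).trans ?_
    rw [abs_mul (m₀ M z.1), abs_mul (χ M z) (m₁ M z.1), abs_of_nonneg (hm₀0 M z.1),
      abs_of_nonneg (hχle M z).1]
    have h2 := mul_le_of_le_one_left (abs_nonneg (χ M z * T z)) (hm₀1 M z.1)
    have h3 := mul_le_of_le_one_left (abs_nonneg (m₁ M z.1)) (hχle M z).2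
    linarith [hχT M z, hm₁b M z.1]
  have hS0 : ∀ M x, ∫ y, χ M (x, y) * S M (x, y) * r (x, y) ∂Q = 0 := fun M x => by
    calc _ = ∫ y, (m₀ M x * (χ M (x, y) * T (x, y) * r (x, y))
          - m₁ M x * (χ M (x, y) * r (x, y))) ∂Q := by
          refine integral_congr_ae (ae_of_all _ fun y => ?_)
          simp only [hS]; ring
      _ = 0 := by
          rw [integral_sub ((hi₁ M x).const_mul _) ((hi₀ M x).const_mul _), integral_const_mul,
            integral_const_mul]
          change m₀ M x * m₁ M x - m₁ M x * m₀ M x = 0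
          ring
  have hkey : ∀ M, ∀ᵐ z ∂(P.prod Q), z ∈ B M → m₀ M z.1 * T z = m₁ M z.1 := fun M => by
    set b : ℝ := 2 * (M + A * M) with hb
    have hb0 : 0 ≤ b := by positivity
    set φ : X × Y → ℝ := fun z => m₀ M z.1 * (χ M z * S M z) with hφ
    have hφdir : φ ∈ directions Q r F c hr.integrable := by
      refine ⟨((hm₀m M).comp measurable_fst).mul ((hχm M).mul (hSm M)),
        ⟨b + M, by positivity, fun z => ?_, fun z hz => ?_⟩, fun x => ?_⟩
      · simp only [hφ]
        rw [abs_mul, abs_of_nonneg (hm₀0 M z.1)]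
        have := mul_le_of_le_one_left (abs_nonneg (χ M z * S M z)) (hm₀1 M z.1)
        have : (0 : ℝ) ≤ M := Nat.cast_nonneg M
        linarith [hχS M z]
      · have hzB : z ∈ B M := by
          by_contra hn
          exact hz (by simp [hφ, hχ, hn])
        exact ⟨by linarith [hzB.1], by linarith [hzB.2]⟩
      · simp only [hφ, mul_assoc]
        rw [integral_const_mul]
        simp only [← mul_assoc]
        rw [hS0 M x, mul_zero]
    have hrP := hr.integrable_prod (P := P)
    have hI : ∀ G : X × Y → ℝ, Measurable G → (∀ z, |G z| ≤ b) →
        Integrable (fun z => G z * (χ M z * S M z * r z)) (P.prod Q) := fun G hG hGb => by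
      refine (hrP.bdd_mul (f := fun z => G z * (χ M z * S M z)) (c := b * b)
        (hG.mul ((hχm M).mul (hSm M))).aestronglyMeasurable (ae_of_all _ fun z => ?_)).congr
        (ae_of_all _ fun z => by ring)
      rw [Real.norm_eq_abs, abs_mul]
      exact mul_le_mul (hGb z) (hχS M z) (abs_nonneg _) hb0
    have hm₁I := hI (fun z => m₁ M z.1) ((hm₁m M).comp measurable_fst) fun z => by
      have := hm₁b M z.1
      have : (0 : ℝ) ≤ M + A * M := by positivity
      simp only [hb]; linarith
    have hSI := hI (fun z => χ M z * S M z) ((hχm M).mul (hSm M)) (hχS M)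
    -- the weighted variance of `T` on `B M` vanishes
    have hvar : ∫ z, χ M z * S M z * (χ M z * S M z * r z) ∂(P.prod Q) = 0 := by
      have h1 : ∫ z, m₁ M z.1 * (χ M z * S M z * r z) ∂(P.prod Q) = 0 := by
        rw [integral_prod _ hm₁I]
        simp [integral_const_mul, hS0]
      have h2 := horth φ hφdir
      have h3 : Integrable (fun z => φ z * r z * T z) (P.prod Q) := by
        refine (hSI.add hm₁I).congr (ae_of_all _ fun z => ?_)
        by_cases hz : z ∈ B M
        · simp only [Pi.add_apply, hφ, hS, hχ, Set.indicator_of_mem hz, Pi.one_apply]; ring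
        · simp [hφ, hχ, hz]
      calc _ = ∫ z, (φ z * r z * T z - m₁ M z.1 * (χ M z * S M z * r z)) ∂(P.prod Q) := by
            refine integral_congr_ae (ae_of_all _ fun z => ?_)
            by_cases hz : z ∈ B M
            · simp only [hφ, hS, hχ, Set.indicator_of_mem hz, Pi.one_apply]; ring
            · simp [hφ, hχ, hz]
        _ = 0 := by rw [integral_sub h3 hm₁I, h1, h2, sub_zero]
    have hnn : ∀ z, 0 ≤ χ M z * S M z * (χ M z * S M z * r z) := fun z => by
      rw [← mul_assoc]
      exact mul_nonneg (mul_self_nonneg _) (hr.nonneg z)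
    have h0 := (integral_eq_zero_iff_of_nonneg hnn hSI).1 hvar
    filter_upwards [h0, hpos] with z hz hrz hzB
    simp only [hχ, Set.indicator_of_mem hzB, Pi.one_apply, one_mul, Pi.zero_apply, hS] at hz
    have : m₀ M z.1 * T z - m₁ M z.1 = 0 := by
      rcases mul_eq_zero.1 hz with h | h
      · exact h
      · exact (mul_eq_zero.1 h).resolve_right hrz.ne'
    linarith
  have hall : ∀ᵐ x ∂P, ∀ᵐ y ∂Q, 0 < r (x, y) ∧
      ∀ M, (x, y) ∈ B M → m₀ M x * T (x, y) = m₁ M x :=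
    Measure.ae_ae_of_ae_prod (p := fun z => 0 < r z ∧ ∀ M, z ∈ B M → m₀ M z.1 * T z = m₁ M z.1)
      (hpos.and (ae_all_iff.2 hkey))
  filter_upwards [hall] with x hx
  obtain ⟨y₀, hy₀⟩ := hx.exists
  refine ⟨T (x, y₀), ?_⟩
  -- for large `M` the set `B M` has positive mass
  have hm₀pos : ∃ M, 0 < m₀ M x := by
    by_contra! hcon
    have h1 : ∀ M, ∀ᵐ y ∂Q, χ M (x, y) * r (x, y) = 0 := fun M =>
      (integral_eq_zero_iff_of_nonneg (fun y => mul_nonneg (hχle M _).1 (hr.nonneg _))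
        (hi₀ M x)).1 (le_antisymm (hcon M) (hm₀0 M x))
    obtain ⟨y, hy, hy'⟩ := (hx.and (ae_all_iff.2 h1)).exists
    obtain ⟨M, hM⟩ := hBex (x, y)
    have := hy' M
    simp only [hχ, Set.indicator_of_mem hM, Pi.one_apply, one_mul] at this
    exact hy.1.ne' this
  obtain ⟨M₀, hM₀⟩ := hm₀pos
  have hmono : ∀ M, M₀ ≤ M → 0 < m₀ M x := fun M hM => by
    refine hM₀.trans_le (integral_mono (hi₀ _ x) (hi₀ _ x) fun y => ?_)
    refine mul_le_mul_of_nonneg_right ?_ (hr.nonneg _)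
    exact Set.indicator_le_indicator_of_subset (hBmono hM) (fun _ => zero_le_one) _
  filter_upwards [hx] with y hy
  refine ⟨hy.1, ?_⟩
  obtain ⟨M₁, hM₁⟩ := hBex (x, y)
  obtain ⟨M₂, hM₂⟩ := hBex (x, y₀)
  set M := max M₀ (max M₁ M₂)
  have e1 := hy.2 M (hBmono ((le_max_left _ _).trans (le_max_right _ _)) hM₁)
  have e2 := hy₀.2 M (hBmono ((le_max_right _ _).trans (le_max_right _ _)) hM₂)
  exact mul_left_cancel₀ (hmono M (le_max_left _ _)).ne' (e1.trans e2.symm)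

/-- An optimal density has the Gibbs form `exp (a(x) - β₁ Δ(x, y) - β₂ b(y))`, in which `b(y)` is a
subgradient of the convex function `h y` at `1`. -/
theorem IsOptimalDensity.exists_gibbs {P : Measure X} [IsProbabilityMeasure P] {Q : Measure Y}
    [IsProbabilityMeasure Q] {Δ : X × Y → ℝ} {h : Y → ℝ → ℝ} {β₁ β₂ : ℝ} {r : X × Y → ℝ}
    (hr : IsOptimalDensity P Q Δ h β₁ β₂ r) (hΔ : Measurable Δ)
    (hΔ0 : ∀ z, 0 ≤ Δ z) (hβ₁ : 0 ≤ β₁) (hβ₂ : 0 < β₂) (hh : ∀ y, ConvexOn ℝ (Set.Ioi 0) (h y))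
    (hm : ∀ q : Y → ℝ, Measurable q → Measurable fun y => h y (q y)) :
    ∃ b : Y → ℝ, Measurable b ∧ (∀ y, ∀ q, 0 < q → h y 1 + b y * (q - 1) ≤ h y q) ∧
      ∀ᵐ x ∂P, ∃ a, ∀ᵐ y ∂Q, 0 < r (x, y) ∧
        r (x, y) = Real.exp a * Real.exp (-(β₁ * Δ (x, y)) - β₂ * b y) := by
  obtain ⟨b, hbm, hb, horth⟩ := hr.exists_subgradient hΔ hβ₂ hh hm
  refine ⟨b, hbm, fun y q hq => add_mul_le_of_mem_Icc (hh y) (hb y).1 (hb y).2 hq, ?_⟩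
  have hFm : Measurable (logCost Δ β₁ r) :=
    (Real.measurable_log.comp hr.measurable).add (measurable_const.mul hΔ)
  have hT := ae_exists_forall_ae_eq_of_orthogonal (T := fun z => logCost Δ β₁ r z + β₂ * b z.2)
    (A := β₂) hr.toIsCondDensity (hr.ae_pos hΔ hΔ0 hβ₁ hβ₂.le hh hm) hFm
    (hFm.add (measurable_const.mul (hbm.comp measurable_snd))) (measurable_secantBound hm)
    (fun z => by
      refine (abs_add_le _ _).trans (add_le_add_right ?_ _)
      rw [abs_mul, abs_of_pos hβ₂]
      refine mul_le_mul_of_nonneg_left ?_ hβ₂.le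
      have h1 := abs_le.1 (abs_rightSlope_le (hh z.2))
      have h2 := abs_le.1 (abs_leftSlope_le (hh z.2))
      exact abs_le.2 ⟨h2.1.trans (hb z.2).1, (hb z.2).2.trans h1.2⟩) hβ₂.le horth
  filter_upwards [hT] with x hx
  obtain ⟨a, ha⟩ := hx
  refine ⟨a, ?_⟩
  filter_upwards [ha] with y hy
  refine ⟨hy.1, ?_⟩
  have h1 := hy.2
  simp only [logCost] at h1
  rw [← Real.exp_add, show a + (-(β₁ * Δ (x, y)) - β₂ * b y) = Real.log (r (x, y)) by linarith,
    Real.exp_log hy.1]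

end Constancy

/-! ### Perspectives and `f`-divergences -/

section Perspective

/-- The perspective `q ↦ q f(s / q)` of the generator `f`: if `s = dP/dQ` then `∫ persp f s q dQ` is
the absolutely continuous part of the divergence of `P` from the measure with `Q`-density `q`. -/
def persp (f : ℝ → ℝ) (s : ℝ≥0∞) (q : ℝ) : ℝ := q * (genExt f (s / ENNReal.ofReal q)).toReal

variable {f : ℝ → ℝ}

lemma persp_zero (f : ℝ → ℝ) (q : ℝ) : persp f 0 q = q * (genExt f 0).toReal := by
  simp [persp]

lemma persp_of_pos {s : ℝ≥0∞} {q : ℝ} (hs : s ≠ 0) (hq : 0 < q) :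
    persp f s q = q * f (s.toReal / q) := by
  have h1 : s / ENNReal.ofReal q ≠ 0 := ENNReal.div_ne_zero.2 ⟨hs, ENNReal.ofReal_ne_top⟩
  rw [persp, genExt, if_neg h1, EReal.toReal_coe, ENNReal.toReal_div, ENNReal.toReal_ofReal hq.le]

lemma persp_one (f : ℝ → ℝ) (s : ℝ≥0∞) : persp f s 1 = (genExt f s).toReal := by
  simp [persp]

lemma convexOn_persp (hf : ConvexOn ℝ (Set.Ioi 0) f) (s : ℝ≥0∞) :
    ConvexOn ℝ (Set.Ioi 0) (persp f s) := by
  refine ⟨convex_Ioi 0, fun q₁ h₁ q₂ h₂ a b ha hb hab => ?_⟩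
  have h₁ : 0 < q₁ := h₁
  have h₂ : 0 < q₂ := h₂
  have hq : 0 < a • q₁ + b • q₂ := convex_Ioi (0 : ℝ) h₁ h₂ ha hb hab
  simp only [smul_eq_mul] at hq ⊢
  by_cases hs : s = 0
  · subst hs
    simp only [persp_zero]
    exact le_of_eq (by ring)
  rw [persp_of_pos hs hq, persp_of_pos hs h₁, persp_of_pos hs h₂]
  rcases (ENNReal.toReal_nonneg (a := s)).eq_or_lt with h0 | h0
  · rw [← h0, zero_div, zero_div, zero_div]
    exact le_of_eq (by ring)
  have h3 := hf.2 (show s.toReal / q₁ ∈ Set.Ioi 0 from div_pos h0 h₁)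
    (show s.toReal / q₂ ∈ Set.Ioi 0 from div_pos h0 h₂)
    (show 0 ≤ a * q₁ / (a * q₁ + b * q₂) by positivity)
    (show 0 ≤ b * q₂ / (a * q₁ + b * q₂) by positivity) (by field_simp)
  simp only [smul_eq_mul] at h3
  have h4 : a * q₁ / (a * q₁ + b * q₂) * (s.toReal / q₁)
      + b * q₂ / (a * q₁ + b * q₂) * (s.toReal / q₂) = s.toReal / (a * q₁ + b * q₂) := by
    field_simp
    rw [hab]
  rw [h4] at h3
  calc _ ≤ (a * q₁ + b * q₂) * _ := mul_le_mul_of_nonneg_left h3 hq.le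
    _ = _ := by field_simp

lemma measurable_genExt (hf : ConvexOn ℝ (Set.Ioi 0) f) : Measurable (genExt f) := by
  classical
  have h1 : Measurable ((Set.Ioi (0 : ℝ)).piecewise f 0) :=
    (hf.continuousOn isOpen_Ioi).measurable_piecewise continuousOn_const measurableSet_Ioi
  have h2 : genExt f = fun t => if t = 0 then limsup (fun u : ℝ => (f u : EReal)) (𝓝[>] (0 : ℝ))
      else if t = ⊤ then (f 0 : EReal) else (((Set.Ioi (0 : ℝ)).piecewise f 0 t.toReal : ℝ) : EReal) := by
    ext t
    simp only [genExt]
    split_ifs with h h'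
    · rfl
    · simp [h']
    · rw [Set.piecewise_eq_of_mem _ _ _ (Set.mem_Ioi.2 (ENNReal.toReal_pos h h'))]
  rw [h2]
  refine Measurable.ite (measurableSet_singleton 0) measurable_const
    (Measurable.ite (measurableSet_singleton ⊤) measurable_const ?_)
  exact (h1.comp ENNReal.measurable_toReal).coe_real_ereal

lemma measurable_persp {Y : Type*} [MeasurableSpace Y] (hf : ConvexOn ℝ (Set.Ioi 0) f)
    {s : Y → ℝ≥0∞} (hs : Measurable s) {q : Y → ℝ} (hq : Measurable q) :
    Measurable fun y => persp f (s y) (q y) :=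
  hq.mul ((measurable_genExt hf).comp (hs.div hq.ennreal_ofReal)).ereal_toReal

end Perspective

section FDiv

variable {E : Type*} [MeasurableSpace E] {f : ℝ → ℝ} {μ ν : Measure E}

lemma toReal_neg_eq (x : EReal) : (-x).toReal = -x.toReal := by
  induction x <;> simp [← EReal.coe_neg]

lemma ne_top_of_sub_add_eq_coe {A B : ℝ≥0∞} {c : EReal} {p : ℝ}
    (h : (A : EReal) - (B : EReal) + c = p) : A ≠ ⊤ ∧ B ≠ ⊤ ∧ ∃ c' : ℝ, c = c' := by
  have hB : B ≠ ⊤ := by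
    rintro rfl
    simp at h
  lift B to NNReal using hB
  have hA : A ≠ ⊤ := by
    rintro rfl
    have h1 : ((⊤ : ℝ≥0∞) : EReal) - ((B : ℝ≥0∞) : EReal) = ⊤ := EReal.top_sub_coe (B : ℝ)
    rw [h1] at h
    induction c <;> simp at h
  lift A to NNReal using hA
  have h1 : ((A : ℝ≥0∞) : EReal) - ((B : ℝ≥0∞) : EReal) = (((A : ℝ) - (B : ℝ) : ℝ) : EReal) := rfl
  rw [h1] at h
  refine ⟨ENNReal.coe_ne_top, ENNReal.coe_ne_top, ?_⟩
  induction c with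
  | bot => simp at h
  | coe c => exact ⟨c, rfl⟩
  | top =>
    rw [EReal.coe_add_top] at h
    exact absurd h.symm (EReal.coe_ne_top p)

lemma lintegral_toENNReal_eq {g : E → EReal} (hg : ∀ᵐ y ∂ν, g y ≠ ⊤ ∧ g y ≠ ⊥) :
    ∫⁻ y, (g y).toENNReal ∂ν = ∫⁻ y, ENNReal.ofReal (g y).toReal ∂ν ∧
    ∫⁻ y, (-g y).toENNReal ∂ν = ∫⁻ y, ENNReal.ofReal (-(g y).toReal) ∂ν := by
  constructor <;> refine lintegral_congr_ae ?_ <;> filter_upwards [hg] with y hy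
  · exact EReal.toENNReal_of_ne_top hy.1
  · rw [EReal.toENNReal_of_ne_top (by simpa using hy.2), toReal_neg_eq]

lemma fDiv_eq_integral_add
    (hfin : ∀ᵐ y ∂ν, genExt f (μ.rnDeriv ν y) ≠ ⊤ ∧ genExt f (μ.rnDeriv ν y) ≠ ⊥)
    (hint : Integrable (fun y => (genExt f (μ.rnDeriv ν y)).toReal) ν) :
    fDiv f μ ν = ((∫ y, (genExt f (μ.rnDeriv ν y)).toReal ∂ν : ℝ) : EReal)
      + slopeAtTop f * ((μ.singularPart ν Set.univ : ℝ≥0∞) : EReal) := by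
  obtain ⟨h1, h2⟩ := lintegral_toENNReal_eq hfin
  have h3 : ∫⁻ y, ENNReal.ofReal (genExt f (μ.rnDeriv ν y)).toReal ∂ν ≠ ⊤ :=
    ((lintegral_ofReal_le_lintegral_enorm _).trans_lt hint.2).ne
  have h4 : ∫⁻ y, ENNReal.ofReal (-(genExt f (μ.rnDeriv ν y)).toReal) ∂ν ≠ ⊤ :=
    ((lintegral_ofReal_le_lintegral_enorm _).trans_lt hint.neg.2).ne
  rw [fDiv, h1, h2, integral_eq_lintegral_pos_part_sub_lintegral_neg_part hint, EReal.coe_sub,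
    EReal.coe_ennreal_toReal h3, EReal.coe_ennreal_toReal h4]

/-- If the divergence is finite, then so are all of its parts. -/
lemma integrable_of_fDiv_eq_coe (hm : Measurable (genExt f)) {p : ℝ} (hp : fDiv f μ ν = p) :
    (∀ᵐ y ∂ν, genExt f (μ.rnDeriv ν y) ≠ ⊤ ∧ genExt f (μ.rnDeriv ν y) ≠ ⊥) ∧
    Integrable (fun y => (genExt f (μ.rnDeriv ν y)).toReal) ν ∧
    ∃ c : ℝ, slopeAtTop f * ((μ.singularPart ν Set.univ : ℝ≥0∞) : EReal) = c := by
  have hgm : Measurable fun y => genExt f (μ.rnDeriv ν y) :=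
    hm.comp (Measure.measurable_rnDeriv μ ν)
  rw [fDiv] at hp
  set A := ∫⁻ y, (genExt f (μ.rnDeriv ν y)).toENNReal ∂ν with hA
  set B := ∫⁻ y, (-genExt f (μ.rnDeriv ν y)).toENNReal ∂ν with hB
  set c := slopeAtTop f * ((μ.singularPart ν Set.univ : ℝ≥0∞) : EReal) with hc
  obtain ⟨hAtop, hBtop, hcr⟩ := ne_top_of_sub_add_eq_coe hp
  have hfin : ∀ᵐ y ∂ν, genExt f (μ.rnDeriv ν y) ≠ ⊤ ∧ genExt f (μ.rnDeriv ν y) ≠ ⊥ := by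
    filter_upwards [ae_lt_top hgm.ereal_toENNReal hAtop,
      ae_lt_top hgm.neg.ereal_toENNReal hBtop] with y h1 h2
    refine ⟨fun h => ?_, fun h => ?_⟩
    · rw [h] at h1; simp at h1
    · simp [h] at h2
  obtain ⟨h1, h2⟩ := lintegral_toENNReal_eq hfin
  refine ⟨hfin, ⟨hgm.ereal_toReal.aestronglyMeasurable, ?_⟩, hcr⟩
  · have h3 : ∀ y, ‖(genExt f (μ.rnDeriv ν y)).toReal‖ₑ
        = ENNReal.ofReal (genExt f (μ.rnDeriv ν y)).toReal
          + ENNReal.ofReal (-(genExt f (μ.rnDeriv ν y)).toReal) := fun y => by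
      rw [← ofReal_norm, Real.norm_eq_abs]
      rcases le_total 0 (genExt f (μ.rnDeriv ν y)).toReal with h | h
      · rw [abs_of_nonneg h, ENNReal.ofReal_of_nonpos (neg_nonpos.2 h), add_zero]
      · rw [abs_of_nonpos h, ENNReal.ofReal_of_nonpos h, zero_add]
    rw [HasFiniteIntegral, lintegral_congr h3,
      lintegral_add_left hgm.ereal_toReal.ennreal_ofReal, ← h1, ← h2]
    exact ENNReal.add_lt_top.2 ⟨hAtop.lt_top, hBtop.lt_top⟩

lemma singularPart_withDensity_right [IsFiniteMeasure μ] [IsFiniteMeasure ν] {q : E → ℝ≥0∞}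
    (hq : Measurable q) (hq0 : ∀ᵐ y ∂ν, q y ≠ 0) (hqt : ∀ᵐ y ∂ν, q y ≠ ∞) :
    μ.singularPart (ν.withDensity q) = μ.singularPart ν := by
  refine (Measure.eq_singularPart (f := fun y => (q y)⁻¹ * μ.rnDeriv ν y)
    (hq.inv.mul (Measure.measurable_rnDeriv μ ν))
    ((Measure.mutuallySingular_singularPart μ ν).mono_ac .rfl
      (withDensity_absolutelyContinuous _ _)) ?_).symm
  have h1 : (ν.withDensity q).withDensity (fun y => (q y)⁻¹ * μ.rnDeriv ν y)
      = ν.withDensity (μ.rnDeriv ν) := by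
    rw [← withDensity_mul _ hq (g := fun y => (q y)⁻¹ * μ.rnDeriv ν y)
      (hq.inv.mul (Measure.measurable_rnDeriv μ ν))]
    refine withDensity_congr_ae ?_
    filter_upwards [hq0, hqt] with y h0 ht
    rw [Pi.mul_apply, ← mul_assoc, ENNReal.mul_inv_cancel h0 ht, one_mul]
  rw [h1]
  exact (Measure.haveLebesgueDecomposition_add μ ν)

lemma fDiv_withDensity [IsFiniteMeasure μ] [IsFiniteMeasure ν]
    (hfin : ∀ᵐ y ∂ν, genExt f (μ.rnDeriv ν y) ≠ ⊤ ∧ genExt f (μ.rnDeriv ν y) ≠ ⊥) {q : E → ℝ}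
    (hq : Measurable q) (hq0 : ∀ᵐ y ∂ν, 0 < q y)
    (hint : Integrable (fun y => persp f (μ.rnDeriv ν y) (q y)) ν) :
    fDiv f μ (ν.withDensity fun y => ENNReal.ofReal (q y))
      = ((∫ y, persp f (μ.rnDeriv ν y) (q y) ∂ν : ℝ) : EReal)
        + slopeAtTop f * ((μ.singularPart ν Set.univ : ℝ≥0∞) : EReal) := by
  set ν' := ν.withDensity fun y => ENNReal.ofReal (q y) with hν'
  have hq0' : ∀ᵐ y ∂ν, ENNReal.ofReal (q y) ≠ 0 := by
    filter_upwards [hq0] with y hy using (ENNReal.ofReal_pos.2 hy).ne'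
  have hqt : ∀ᵐ y ∂ν, ENNReal.ofReal (q y) ≠ ∞ := ae_of_all _ fun y => ENNReal.ofReal_ne_top
  have hac : ν' ≪ ν := withDensity_absolutelyContinuous _ _
  have hrn : ∀ᵐ y ∂ν, μ.rnDeriv ν' y = μ.rnDeriv ν y / ENNReal.ofReal (q y) := by
    filter_upwards [Measure.rnDeriv_withDensity_right μ ν hq.ennreal_ofReal.aemeasurable hq0' hqt]
      with y hy
    rw [hy, ENNReal.div_eq_inv_mul]
  have hval : ∀ᵐ y ∂ν, (ENNReal.ofReal (q y)).toReal • (genExt f (μ.rnDeriv ν' y)).toReal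
      = persp f (μ.rnDeriv ν y) (q y) := by
    filter_upwards [hrn, hq0] with y h1 h2
    rw [h1, ENNReal.toReal_ofReal h2.le, persp, smul_eq_mul]
  have hfin' : ∀ᵐ y ∂ν', genExt f (μ.rnDeriv ν' y) ≠ ⊤ ∧ genExt f (μ.rnDeriv ν' y) ≠ ⊥ := by
    refine hac.ae_le ?_
    filter_upwards [hrn, hfin] with y h1 h2
    rw [h1]
    by_cases h0 : μ.rnDeriv ν y = 0
    · simpa [h0] using h2
    · have h3 : μ.rnDeriv ν y / ENNReal.ofReal (q y) ≠ 0 :=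
        ENNReal.div_ne_zero.2 ⟨h0, ENNReal.ofReal_ne_top⟩
      simp [genExt, h3]
  have hint' : Integrable (fun y => (genExt f (μ.rnDeriv ν' y)).toReal) ν' := by
    rw [hν', integrable_withDensity_iff_integrable_smul' hq.ennreal_ofReal
      (ae_of_all _ fun y => ENNReal.ofReal_lt_top)]
    exact hint.congr (hval.mono fun y hy => hy.symm)
  rw [fDiv_eq_integral_add hfin' hint', hν', singularPart_withDensity_right hq.ennreal_ofReal hq0' hqt,
    integral_withDensity_eq_integral_toReal_smul hq.ennreal_ofReal
      (ae_of_all _ fun y => ENNReal.ofReal_lt_top), integral_congr_ae hval]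

end FDiv

/-! ### Channels with a density -/

section Channel

variable {E : Type*} [MeasurableSpace E]

/-- Replacing the output law of a channel by another law `Q` can only increase the divergence of
the joint law from the product law; the difference is the divergence of the output law from `Q`. -/
lemma mutualInfo_le_klDiv_prod [StandardBorelSpace E] (P : Measure E) [IsProbabilityMeasure P]
    (Q : Measure E) [IsProbabilityMeasure Q] (κ : Kernel E E) [IsMarkovKernel κ] :
    mutualInfo P κ ≤ klDiv (P ⊗ₘ κ) (P.prod Q) := by
  have : Nonempty E := by
    by_contra hX
    rw [not_nonempty_iff] at hX
    exact IsProbabilityMeasure.ne_zero P (Measure.eq_zero_of_isEmpty P)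
  set Q' := κ ∘ₘ P with hQ'
  have h1 : (P ⊗ₘ κ) = (Q' ⊗ₘ κ†P).map Prod.swap := by
    rw [compProd_posterior_eq_map_swap, Measure.map_map measurable_swap measurable_swap]
    simp
  calc mutualInfo P κ = klDiv ((Q' ⊗ₘ κ†P).map Prod.swap)
        ((Q' ⊗ₘ Kernel.const E P).map Prod.swap) := by
        rw [mutualInfo, ← h1, Measure.compProd_const, Measure.prod_swap]
    _ ≤ klDiv (Q' ⊗ₘ κ†P) (Q' ⊗ₘ Kernel.const E P) := klDiv_map_le _ _ measurable_swap
    _ ≤ klDiv (Q' ⊗ₘ κ†P) (Q ⊗ₘ Kernel.const E P) := by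
        rw [klDiv_compProd_eq_add Q' Q]
        exact le_add_self
    _ = klDiv ((P ⊗ₘ κ).map Prod.swap) ((P.prod Q).map Prod.swap) := by
        rw [compProd_posterior_eq_map_swap, Measure.compProd_const, Measure.prod_swap]
    _ ≤ klDiv (P ⊗ₘ κ) (P.prod Q) := klDiv_map_le _ _ measurable_swap

/-- The channel with conditional density `ρ` with respect to `Q`. -/
def densityChannel (Q : Measure E) [IsProbabilityMeasure Q] (ρ : E × E → ℝ) : Kernel E E :=
  Kernel.withDensity (Kernel.const E Q) fun x y => ENNReal.ofReal (ρ (x, y))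

variable {P Q : Measure E} [IsProbabilityMeasure P] [IsProbabilityMeasure Q] {ρ : E × E → ℝ}

lemma densityChannel_apply (hρ : IsCondDensity Q ρ) (x : E) :
    densityChannel Q ρ x = Q.withDensity fun y => ENNReal.ofReal (ρ (x, y)) := by
  rw [densityChannel, Kernel.withDensity_apply _ hρ.measurable.ennreal_ofReal, Kernel.const_apply]

lemma IsCondDensity.isMarkovKernel (hρ : IsCondDensity Q ρ) :
    IsMarkovKernel (densityChannel Q ρ) := by
  refine ⟨fun x => ⟨?_⟩⟩
  rw [densityChannel_apply hρ, withDensity_apply _ MeasurableSet.univ, setLIntegral_univ,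
    ← ofReal_integral_eq_lintegral_ofReal (hρ.integrable x) (ae_of_all _ fun y => hρ.nonneg _),
    hρ.integral_eq_one, ENNReal.ofReal_one]

lemma compProd_densityChannel (hρ : IsCondDensity Q ρ) :
    P ⊗ₘ densityChannel Q ρ = (P.prod Q).withDensity fun z => ENNReal.ofReal (ρ z) := by
  have := hρ.isMarkovKernel
  have : IsSFiniteKernel (Kernel.withDensity (Kernel.const E Q)
      fun x y => ENNReal.ofReal (ρ (x, y))) :=
    inferInstanceAs (IsSFiniteKernel (densityChannel Q ρ))
  rw [densityChannel, Measure.compProd_withDensity hρ.measurable.ennreal_ofReal,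
    Measure.compProd_const]

lemma comp_densityChannel (hρ : IsCondDensity Q ρ) :
    densityChannel Q ρ ∘ₘ P = Q.withDensity fun y => ∫⁻ x, ENNReal.ofReal (ρ (x, y)) ∂P := by
  have := hρ.isMarkovKernel
  ext s hs
  rw [← Measure.snd_compProd, Measure.snd_apply hs, compProd_densityChannel hρ,
    withDensity_apply _ (measurable_snd hs), withDensity_apply _ hs,
    ← lintegral_indicator (measurable_snd hs), ← lintegral_indicator hs,
    lintegral_prod_symm' _ (hρ.measurable.ennreal_ofReal.indicator (measurable_snd hs))]
  refine lintegral_congr fun y => ?_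
  by_cases hy : y ∈ s <;> simp [Set.indicator, hy]

lemma comp_densityChannel_of_marginal (hρ : IsCondDensity Q ρ) {q : E → ℝ}
    (hq : ∀ᵐ y ∂Q, ∫ x, ρ (x, y) ∂P = q y) (hq0 : ∀ᵐ y ∂Q, 0 < q y) :
    densityChannel Q ρ ∘ₘ P = Q.withDensity fun y => ENNReal.ofReal (q y) := by
  rw [comp_densityChannel hρ]
  refine withDensity_congr_ae ?_
  filter_upwards [hq, hq0] with y h1 h2
  have hi : Integrable (fun x => ρ (x, y)) P := by
    by_contra hn
    rw [integral_undef hn] at h1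
    exact h2.ne h1
  rw [← h1, ofReal_integral_eq_lintegral_ofReal hi (ae_of_all _ fun x => hρ.nonneg _)]

lemma klDiv_densityChannel (hρ : IsCondDensity Q ρ) :
    klDiv (P ⊗ₘ densityChannel Q ρ) (P.prod Q)
      = ∫⁻ z, ENNReal.ofReal (klFun (ρ z)) ∂(P.prod Q) := by
  have := hρ.isMarkovKernel
  have hac : P ⊗ₘ densityChannel Q ρ ≪ P.prod Q := by
    rw [compProd_densityChannel hρ]
    exact withDensity_absolutelyContinuous _ _
  rw [klDiv_eq_lintegral_klFun_of_ac hac]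
  refine lintegral_congr_ae ?_
  rw [compProd_densityChannel hρ]
  filter_upwards [Measure.rnDeriv_withDensity (P.prod Q) hρ.measurable.ennreal_ofReal] with z hz
  rw [hz, ENNReal.toReal_ofReal (hρ.nonneg z)]

lemma expDistortion_densityChannel {Δ : E → E → ℝ} (hΔ : Measurable (Function.uncurry Δ))
    (hρ : IsCondDensity Q ρ) :
    expDistortion P Δ (densityChannel Q ρ)
      = ∫⁻ z, ENNReal.ofReal (Function.uncurry Δ z * ρ z) ∂(P.prod Q) := by
  rw [expDistortion, compProd_densityChannel hρ,
    lintegral_withDensity_eq_lintegral_mul _ hρ.measurable.ennreal_ofReal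
      (g := fun z : E × E => ENNReal.ofReal (Δ z.1 z.2)) hΔ.ennreal_ofReal]
  refine lintegral_congr fun z => ?_
  rw [Pi.mul_apply, ← ENNReal.ofReal_mul (hρ.nonneg z), mul_comm]
  rfl

/-- A channel of finite information has a conditional density with respect to its output law. -/
lemma exists_condDensity_of_absolutelyContinuous [StandardBorelSpace E] {κ : Kernel E E}
    [IsMarkovKernel κ] (hac : P ⊗ₘ κ ≪ P.prod Q) :
    ∃ r : E × E → ℝ, IsCondDensity Q r ∧ κ =ᵐ[P] densityChannel Q r := by
  set R : E × E → ℝ := fun z => ((P ⊗ₘ κ).rnDeriv (P.prod Q) z).toReal with hR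
  have hRm : Measurable R := (Measure.measurable_rnDeriv _ _).ennreal_toReal
  have hRwd : P ⊗ₘ κ = (P.prod Q).withDensity fun z => ENNReal.ofReal (R z) := by
    conv_lhs => rw [← Measure.withDensity_rnDeriv_eq _ _ hac]
    refine withDensity_congr_ae ?_
    filter_upwards [Measure.rnDeriv_ne_top (P ⊗ₘ κ) (P.prod Q)] with z hz
    exact (ENNReal.ofReal_toReal hz).symm
  set m : E → ℝ≥0∞ := fun x => ∫⁻ y, ENNReal.ofReal (R (x, y)) ∂Q with hm
  have hmm : Measurable m := hRm.ennreal_ofReal.lintegral_prod_right'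
  have hm1 : ∀ᵐ x ∂P, m x = 1 := by
    have h1 : P.withDensity m = P.withDensity 1 := by
      ext s hs
      have h2 : (P ⊗ₘ κ).fst s = P s := by rw [Measure.fst_compProd]
      rw [withDensity_one, ← h2, Measure.fst_apply hs, hRwd,
        withDensity_apply _ (measurable_fst hs), withDensity_apply _ hs,
        ← lintegral_indicator (measurable_fst hs), ← lintegral_indicator hs,
        lintegral_prod _ (hRm.ennreal_ofReal.indicator (measurable_fst hs)).aemeasurable]
      refine lintegral_congr fun x => ?_
      by_cases hx : x ∈ s <;> simp [Set.indicator, hx, hm]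
    exact (withDensity_eq_iff_of_sigmaFinite hmm.aemeasurable aemeasurable_one).1 h1
  -- `r` is changed to the constant `1` on the null set of `x` where it is not a density
  set A : Set E := {x | m x = 1} with hA
  have hAm : MeasurableSet A := hmm (measurableSet_singleton 1)
  classical
  set r : E × E → ℝ := (Prod.fst ⁻¹' A).piecewise R 1 with hr
  have hrm : Measurable r := hRm.piecewise (measurable_fst hAm) measurable_one
  have hrA : ∀ x ∈ A, ∀ y, r (x, y) = R (x, y) := fun x hx y =>
    Set.piecewise_eq_of_mem _ _ _ (show (x, y) ∈ Prod.fst ⁻¹' A from hx)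
  have hrA' : ∀ x ∉ A, ∀ y, r (x, y) = 1 := fun x hx y =>
    Set.piecewise_eq_of_notMem _ _ _ (show (x, y) ∉ Prod.fst ⁻¹' A from hx)
  have hr0 : ∀ z, 0 ≤ r z := fun z => by
    by_cases hz : z.1 ∈ A
    · rw [hrA z.1 hz z.2]; exact ENNReal.toReal_nonneg
    · rw [hrA' z.1 hz z.2]; exact zero_le_one
  have hr1 : ∀ x, ∫⁻ y, ENNReal.ofReal (r (x, y)) ∂Q = 1 := fun x => by
    by_cases hx : x ∈ A
    · simp only [hrA x hx]; exact hx
    · simp [hrA' x hx]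
  have hri : ∀ x, Integrable (fun y => r (x, y)) Q := fun x => by
    refine ⟨(hrm.comp measurable_prodMk_left).aestronglyMeasurable, ?_⟩
    rw [hasFiniteIntegral_iff_ofReal (ae_of_all _ fun y => hr0 _), hr1 x]
    exact ENNReal.one_lt_top
  have hrd : IsCondDensity Q r := by
    refine ⟨hrm, hr0, hri, fun x => ?_⟩
    rw [integral_eq_lintegral_of_nonneg_ae (ae_of_all _ fun y => hr0 _) (hri x).1, hr1 x,
      ENNReal.toReal_one]
  refine ⟨r, hrd, ?_⟩
  have := hrd.isMarkovKernel
  refine Kernel.ae_eq_of_compProd_eq ?_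
  rw [compProd_densityChannel hrd, hRwd]
  refine withDensity_congr_ae ?_
  have h3 : ∀ᵐ z ∂(P.prod Q), z.1 ∈ A := Measure.quasiMeasurePreserving_fst.ae hm1
  filter_upwards [h3] with z hz
  rw [hrA z.1 hz z.2]

lemma integrable_and_integral_eq_of_lintegral_ofReal {α : Type*} [MeasurableSpace α]
    {μ : Measure α} {g : α → ℝ} (hg : Measurable g) (hg0 : ∀ z, 0 ≤ g z)
    (h : ∫⁻ z, ENNReal.ofReal (g z) ∂μ ≠ ⊤) :
    Integrable g μ ∧ ((∫⁻ z, ENNReal.ofReal (g z) ∂μ : ℝ≥0∞) : EReal)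
      = ((∫ z, g z ∂μ : ℝ) : EReal) := by
  have hi : Integrable g μ := ⟨hg.aestronglyMeasurable, by
    rw [hasFiniteIntegral_iff_ofReal (ae_of_all _ hg0)]; exact h.lt_top⟩
  refine ⟨hi, ?_⟩
  rw [← ofReal_integral_eq_lintegral_ofReal hi (ae_of_all _ hg0), EReal.coe_ennreal_ofReal,
    max_eq_left (integral_nonneg hg0)]

/-- A channel that achieves `R(D, p)` has an optimal density: the Lagrangian of every other channel
is at least as large, and so is, all the more, its upper bound in which the mutual information is
replaced by the divergence from the product of `P` and the original output law. -/
theorem exists_isOptimalDensity [StandardBorelSpace E] {Δ : E → E → ℝ}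
    (hΔ : Measurable (Function.uncurry Δ)) (hΔ0 : ∀ x y, 0 ≤ Δ x y)
    {f : ℝ → ℝ} (hf : ConvexOn ℝ (Set.Ioi 0) f) (κ : Kernel E E) [IsMarkovKernel κ]
    {D p β₁ β₂ : ℝ} (hD : (expDistortion P Δ κ : EReal) = (D : EReal))
    (hp : fDiv f P (κ ∘ₘ P) = (p : EReal)) (hκ : IsRDPAchieving P Δ f D p κ)
    (hR : rdpFunction P Δ f D p ≠ ∞) (hβ : IsLagrangeMultiplier P Δ f D p β₁ β₂) :
    ∃ r : E × E → ℝ, IsOptimalDensity P (κ ∘ₘ P) (Function.uncurry Δ)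
        (fun y => persp f (P.rnDeriv (κ ∘ₘ P) y)) β₁ β₂ r ∧
      κ =ᵐ[P] densityChannel (κ ∘ₘ P) r := by
  set Q := κ ∘ₘ P with hQ
  have hI : klDiv (P ⊗ₘ κ) (P.prod Q) = rdpFunction P Δ f D p := hκ.2
  have hac : P ⊗ₘ κ ≪ P.prod Q := (klDiv_ne_top_iff.1 (hI.trans_ne hR)).1
  obtain ⟨r, hr, hκr⟩ := exists_condDensity_of_absolutelyContinuous hac
  refine ⟨r, ?_, hκr⟩
  have hΔ0' : ∀ z, 0 ≤ Function.uncurry Δ z := fun z => hΔ0 z.1 z.2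
  have hrk := hr.isMarkovKernel
  have hcp : P ⊗ₘ κ = P ⊗ₘ densityChannel Q r := Measure.compProd_congr hκr
  have hout : densityChannel Q r ∘ₘ P = Q := by
    rw [← Measure.snd_compProd, ← hcp, Measure.snd_compProd]
  have hkl : ∫⁻ z, ENNReal.ofReal (klFun (r z)) ∂(P.prod Q) = rdpFunction P Δ f D p := by
    rw [← klDiv_densityChannel hr, ← hcp, hI]
  obtain ⟨hkli, hkle⟩ := integrable_and_integral_eq_of_lintegral_ofReal
    (measurable_klFun.comp hr.measurable) (fun z => klFun_nonneg (hr.nonneg z))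
    (hkl.trans_ne hR)
  have hkle : ((rdpFunction P Δ f D p : ℝ≥0∞) : EReal)
    = ((∫ z, klFun (r z) ∂(P.prod Q) : ℝ) : EReal) := by rw [← hkl]; exact hkle
  have hexp : ∫⁻ z, ENNReal.ofReal (Function.uncurry Δ z * r z) ∂(P.prod Q)
      = expDistortion P Δ κ := by
    rw [← expDistortion_densityChannel hΔ hr, expDistortion, expDistortion, hcp]
  obtain ⟨hci, hce⟩ := integrable_and_integral_eq_of_lintegral_ofReal (hΔ.mul hr.measurable)
    (fun z => mul_nonneg (hΔ0' z) (hr.nonneg z)) (by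
      simp only [Pi.mul_apply]
      rw [hexp]
      intro h
      rw [h] at hD
      exact absurd hD.symm (EReal.coe_ne_top D))
  simp only [Pi.mul_apply] at hci hce
  have hDe : D = ∫ z, Function.uncurry Δ z * r z ∂(P.prod Q) := by
    rw [hexp, hD] at hce
    exact_mod_cast hce
  have hmarg : ∀ᵐ y ∂Q, ∫ x, r (x, y) ∂P = 1 := by
    have hm : Measurable fun y => ∫⁻ x, ENNReal.ofReal (r (x, y)) ∂P :=
      hr.measurable.ennreal_ofReal.lintegral_prod_left'
    have h1 : Q.withDensity (fun y => ∫⁻ x, ENNReal.ofReal (r (x, y)) ∂P) = Q.withDensity 1 := by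
      rw [withDensity_one, ← comp_densityChannel hr, hout]
    filter_upwards [(withDensity_eq_iff_of_sigmaFinite hm.aemeasurable aemeasurable_one).1 h1]
      with y hy
    rw [integral_eq_lintegral_of_nonneg_ae (ae_of_all _ fun x => hr.nonneg _)
      (hr.measurable.comp measurable_prodMk_right).aestronglyMeasurable, hy]
    simp
  obtain ⟨hfin, hint, c, hc⟩ := integrable_of_fDiv_eq_coe (measurable_genExt hf) hp
  have hpe : p = ∫ y, persp f (P.rnDeriv Q y) 1 ∂Q + c := by
    rw [fDiv_eq_integral_add hfin hint, hc, ← EReal.coe_add] at hp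
    simp only [persp_one]
    exact_mod_cast hp.symm
  refine ⟨hr, hmarg, hkli, hci, fun ρ q hρ hklρ hcρ hq hqρ hq1 hhi => ?_⟩
  have hmk := hρ.isMarkovKernel
  have hq0 : ∀ᵐ y ∂Q, 0 < q y := by
    filter_upwards [hq1] with y hy
    linarith [(abs_le.1 hy).1]
  have hpi1 : Integrable (fun y => persp f (P.rnDeriv Q y) 1) Q := by
    simpa only [persp_one] using hint
  have hpi : Integrable (fun y => persp f (P.rnDeriv Q y) (q y)) Q :=
    (hhi.add hpi1).congr (ae_of_all _ fun y => sub_add_cancel _ _)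
  have hL := hβ.2.2 (densityChannel Q ρ) hmk
  have e1 : ((mutualInfo P (densityChannel Q ρ) : ℝ≥0∞) : EReal)
      ≤ ((∫ z, klFun (ρ z) ∂(P.prod Q) : ℝ) : EReal) := by
    have h1 := mutualInfo_le_klDiv_prod P Q (densityChannel Q ρ)
    rw [klDiv_densityChannel hρ, ← ofReal_integral_eq_lintegral_ofReal hklρ
      (ae_of_all _ fun z => klFun_nonneg (hρ.nonneg z))] at h1
    calc _ ≤ _ := EReal.coe_ennreal_le_coe_ennreal_iff.2 h1
      _ = _ := by
        rw [EReal.coe_ennreal_ofReal,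
          max_eq_left (integral_nonneg fun z => klFun_nonneg (hρ.nonneg z))]
  have e2 : ((expDistortion P Δ (densityChannel Q ρ) : ℝ≥0∞) : EReal)
      = ((∫ z, Function.uncurry Δ z * ρ z ∂(P.prod Q) : ℝ) : EReal) := by
    rw [expDistortion_densityChannel hΔ hρ, ← ofReal_integral_eq_lintegral_ofReal hcρ
      (ae_of_all _ fun z => mul_nonneg (hΔ0' z) (hρ.nonneg z)), EReal.coe_ennreal_ofReal,
      max_eq_left (integral_nonneg fun z => mul_nonneg (hΔ0' z) (hρ.nonneg z))]
  have e3 : fDiv f P (densityChannel Q ρ ∘ₘ P)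
      = ((∫ y, persp f (P.rnDeriv Q y) (q y) ∂Q + c : ℝ) : EReal) := by
    rw [comp_densityChannel_of_marginal hρ hqρ hq0, fDiv_withDensity hfin hq hq0 hpi, hc,
      EReal.coe_add]
  rw [e2, e3, hkle] at hL
  have hL' : ((∫ z, klFun (r z) ∂(P.prod Q) + (β₁ * D + β₂ * p) : ℝ) : EReal)
      ≤ ((∫ z, klFun (ρ z) ∂(P.prod Q) + β₁ * ∫ z, Function.uncurry Δ z * ρ z ∂(P.prod Q)
        + β₂ * (∫ y, persp f (P.rnDeriv Q y) (q y) ∂Q + c) : ℝ) : EReal) := by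
    calc _ = _ := EReal.coe_add _ _
      _ ≤ _ := hL
      _ ≤ ((∫ z, klFun (ρ z) ∂(P.prod Q) : ℝ) : EReal)
          + (β₁ : EReal) * ((∫ z, Function.uncurry Δ z * ρ z ∂(P.prod Q) : ℝ) : EReal)
          + (β₂ : EReal) * ((∫ y, persp f (P.rnDeriv Q y) (q y) ∂Q + c : ℝ) : EReal) := by
        gcongr
      _ = _ := by simp only [EReal.coe_add, EReal.coe_mul]
  have hL'' := EReal.coe_le_coe_iff.1 hL'
  change Integrable (fun z => klFun (ρ z)) (P.prod Q) at hklρ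
  change Integrable (fun z => klFun (r z)) (P.prod Q) at hkli
  change Integrable (fun z => Function.uncurry Δ z * ρ z) (P.prod Q) at hcρ
  change Integrable (fun z => Function.uncurry Δ z * r z) (P.prod Q) at hci
  change 0 ≤ ∫ z, (klFun (ρ z) - klFun (r z)) ∂(P.prod Q)
    + β₁ * ∫ z, (Function.uncurry Δ z * ρ z - Function.uncurry Δ z * r z) ∂(P.prod Q)
    + β₂ * ∫ y, (persp f (P.rnDeriv Q y) (q y) - persp f (P.rnDeriv Q y) 1) ∂Q
  rw [integral_sub hklρ hkli, integral_sub hcρ hci, integral_sub hpi hpi1]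
  rw [hDe, hpe] at hL''
  linarith

end Channel

/-! ### The Poisson functional representation and the perception penalty -/

section PoissonFunctionalRepresentation

variable {E Ω : Type*} [MeasurableSpace E]

lemma expMeasure_Iic_zero : expMeasure 1 (Set.Iic 0) = 0 := by
  have : IsProbabilityMeasure (expMeasure 1) := isProbabilityMeasure_expMeasure one_pos
  rw [← ofReal_cdf, cdf_expMeasure_eq one_pos]
  simp

lemma IsPoissonCodebook.ae_arrival_pos [MeasurableSpace Ω] {μ : Measure Ω} {Q : Measure E} {τ : ℕ → Ω → ℝ}
    {Xhat : ℕ → Ω → E} (h : IsPoissonCodebook μ Q τ Xhat) : ∀ᵐ ω ∂μ, ∀ i, 0 < arrival τ i ω := by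
  have h1 : ∀ᵐ ω ∂μ, ∀ i, 0 < τ i ω := by
    refine ae_all_iff.2 fun i => ?_
    have h2 : ∀ᵐ t ∂(μ.map (τ i)), 0 < t := by
      rw [h.law_time i, ae_iff]
      simpa [Set.Iic] using expMeasure_Iic_zero
    exact ae_of_ae_map (h.measurable_time i).aemeasurable h2
  filter_upwards [h1] with ω hω i
  exact Finset.sum_pos (fun j _ => hω j) (by simp)

/-- If the density of the channel is `w / Z` with `w = exp (-β₁ Δ - β₂ g)`, then the objective of the
Poisson functional representation is an increasing function of the regularized distance. -/
lemma isMinOn_pfrObjective_iff {Δ : E → E → ℝ} {f : ℝ → ℝ} {ξ : E → ℝ} {P Q κₓ : Measure E}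
    {β₁ β₂ Z : ℝ} (hβ₁ : 0 < β₁) (hZ : 0 < Z) {τ : ℕ → Ω → ℝ} {Xhat : ℕ → Ω → E} {x : E} {ω : Ω}
    (hW : ∀ i, 0 < arrival τ i ω)
    (hrn : ∀ i, Q.rnDeriv κₓ (Xhat i ω)
      = (ENNReal.ofReal (gibbsWeight Δ f ξ P Q β₁ β₂ x (Xhat i ω) / Z))⁻¹) (k : ℕ) :
    IsMinOn (pfrObjective Q κₓ τ Xhat ω) Set.univ k ↔
      IsMinOn (vqObjective Δ f ξ P Q β₁ β₂ τ Xhat x ω) Set.univ k := by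
  have key : ∀ i, pfrObjective Q κₓ τ Xhat ω i = ENNReal.ofReal
      (Real.exp (β₁ * vqObjective Δ f ξ P Q β₁ β₂ τ Xhat x ω i + Real.log Z)) := fun i => by
    have hw : 0 < gibbsWeight Δ f ξ P Q β₁ β₂ x (Xhat i ω) := Real.exp_pos _
    rw [pfrObjective, hrn i, ← ENNReal.ofReal_inv_of_pos (div_pos hw hZ),
      ← ENNReal.ofReal_mul (hW i).le]
    congr 1
    have h1 : β₁ * vqObjective Δ f ξ P Q β₁ β₂ τ Xhat x ω i
        = -(-(β₁ * Δ x (Xhat i ω)) - β₂ * perceptionPenalty f ξ P Q (Xhat i ω))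
          + Real.log (arrival τ i ω) := by
      rw [vqObjective]
      field_simp
      ring
    rw [h1, Real.exp_add, Real.exp_add, Real.exp_log (hW i), Real.exp_log hZ, Real.exp_neg,
      inv_div, gibbsWeight]
    field_simp
  simp only [isMinOn_univ_iff, key]
  refine forall_congr' fun i => ?_
  rw [ENNReal.ofReal_le_ofReal_iff (Real.exp_pos _).le, Real.exp_le_exp, add_le_add_iff_right,
    mul_le_mul_iff_right₀ hβ₁]

end PoissonFunctionalRepresentation

section Penalty

variable {f : ℝ → ℝ}

/-- A subgradient of the perspective in `q` at `q = 1` is `f(s) - s ξ` for a subgradient `ξ` of `f`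
at `s`. -/
lemma isSubgradient_of_persp {s : ℝ≥0∞} {b : ℝ} (hs : 0 < s) (hst : s ≠ ∞)
    (hb : ∀ q, 0 < q → persp f s 1 + b * (q - 1) ≤ persp f s q) :
    IsSubgradient f s.toReal (((genExt f s).toReal - b) / s.toReal) := by
  intro t ht
  have hs' : 0 < s.toReal := ENNReal.toReal_pos hs.ne' hst
  have h1 := hb (s.toReal / t) (div_pos hs' ht)
  rw [persp_of_pos hs.ne' one_pos, persp_of_pos hs.ne' (div_pos hs' ht), one_mul, div_one,
    div_div_cancel₀ hs'.ne'] at h1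
  have h2 : (genExt f s).toReal = f s.toReal := by simp [genExt, hs.ne']
  rw [h2]
  have h3 := mul_le_mul_of_nonneg_left h1 (div_pos ht hs').le
  have h4 : t / s.toReal * (s.toReal / t * f t) = f t := by field_simp
  rw [h4] at h3
  refine le_trans (le_of_eq ?_) h3
  field_simp
  ring

lemma eq_genExt_zero_of_persp {b : ℝ}
    (hb : ∀ q, 0 < q → persp f 0 1 + b * (q - 1) ≤ persp f 0 q) : b = (genExt f 0).toReal := by
  have h1 := hb 2 (by norm_num)
  have h2 := hb (1 / 2) (by norm_num)
  simp only [persp_zero] at h1 h2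
  linarith

lemma perceptionPenalty_eq {E : Type*} [MeasurableSpace E] {P Q : Measure E} {b : E → ℝ} {y : E}
    (hst : P.rnDeriv Q y ≠ ∞)
    (hb : ∀ q, 0 < q → persp f (P.rnDeriv Q y) 1 + b y * (q - 1) ≤ persp f (P.rnDeriv Q y) q) :
    perceptionPenalty f (fun y => ((genExt f (P.rnDeriv Q y)).toReal - b y)
      / (P.rnDeriv Q y).toReal) P Q y = b y := by
  rw [perceptionPenalty]
  by_cases h0 : P.rnDeriv Q y = 0
  · rw [h0] at hb
    simp [h0, eq_genExt_zero_of_persp hb]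
  · have : (P.rnDeriv Q y).toReal ≠ 0 := ENNReal.toReal_ne_zero.2 ⟨h0, hst⟩
    field_simp
    ring

end Penalty

end RDP

end

theorem mainTheorem4 {E : Type u} [MeasurableSpace E] [StandardBorelSpace E]
    (P : Measure E) [IsProbabilityMeasure P]
    (Δ : E → E → ℝ) (hΔ : Measurable (Function.uncurry Δ)) (hΔ0 : ∀ x y, 0 ≤ Δ x y)
    (f : ℝ → ℝ) (hf : ConvexOn ℝ (Set.Ioi 0) f) (hf1 : f 1 = 0)
    (κ : Kernel E E) [IsMarkovKernel κ] (D p β₁ β₂ : ℝ)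
    (hD : (RDP.expDistortion P Δ κ : EReal) = (D : EReal))
    (hp : RDP.fDiv f P (κ ∘ₘ P) = (p : EReal))
    (hκ : RDP.IsRDPAchieving P Δ f D p κ)
    (hR : RDP.rdpFunction P Δ f D p ≠ ∞)
    (hβ : RDP.IsLagrangeMultiplier P Δ f D p β₁ β₂) (hβ₁ : 0 < β₁) (hβ₂ : 0 < β₂) :
    ∃ ξ : E → ℝ, Measurable ξ ∧
      -- `ξ(y) ∈ ∂f(dP/dQ(y))`
      (∀ᵐ y ∂(κ ∘ₘ P), 0 < P.rnDeriv (κ ∘ₘ P) y →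
        RDP.IsSubgradient f (P.rnDeriv (κ ∘ₘ P) y).toReal (ξ y)) ∧
      -- the density ratio of the channel to its output marginal has the Gibbs form
      (∀ᵐ x ∂P, κ x ≪ κ ∘ₘ P ∧ κ ∘ₘ P ≪ κ x ∧
        Integrable (RDP.gibbsWeight Δ f ξ P (κ ∘ₘ P) β₁ β₂ x) (κ ∘ₘ P) ∧
        ∀ᵐ y ∂(κ ∘ₘ P), (κ x).rnDeriv (κ ∘ₘ P) y = ENNReal.ofReal
          (RDP.gibbsWeight Δ f ξ P (κ ∘ₘ P) β₁ β₂ x y /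
            ∫ y', RDP.gibbsWeight Δ f ξ P (κ ∘ₘ P) β₁ β₂ x y' ∂(κ ∘ₘ P))) ∧
      -- both index selection rules have the same minimizers
      (∀ (Ω : Type v) [MeasurableSpace Ω] (μ : Measure Ω) [IsProbabilityMeasure μ]
        (τ : ℕ → Ω → ℝ) (Xhat : ℕ → Ω → E), RDP.IsPoissonCodebook μ (κ ∘ₘ P) τ Xhat →
        ∀ᵐ x ∂P, ∀ᵐ ω ∂μ, ∀ k : ℕ,
          IsMinOn (RDP.pfrObjective (κ ∘ₘ P) (κ x) τ Xhat ω) Set.univ k ↔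
            IsMinOn (RDP.vqObjective Δ f ξ P (κ ∘ₘ P) β₁ β₂ τ Xhat x ω) Set.univ k) := by
  obtain ⟨r, hr, hκr⟩ := RDP.exists_isOptimalDensity hΔ hΔ0 hf κ hD hp hκ hR hβ
  obtain ⟨b, hbm, hb, hgibbs⟩ := hr.exists_gibbs hΔ (fun z => hΔ0 z.1 z.2) hβ₁.le hβ₂
    (fun y => RDP.convexOn_persp hf _)
    (fun q hq => RDP.measurable_persp hf (Measure.measurable_rnDeriv _ _) hq)
  set Q := κ ∘ₘ P with hQ
  -- `ξ` solves `b = f(s) - s ξ`, where `s = dP/dQ`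
  set ξ : E → ℝ := fun y => ((RDP.genExt f (P.rnDeriv Q y)).toReal - b y)
    / (P.rnDeriv Q y).toReal with hξ
  have hsm := Measure.measurable_rnDeriv P Q
  have hpen : ∀ᵐ y ∂Q, RDP.perceptionPenalty f ξ P Q y = b y := by
    filter_upwards [Measure.rnDeriv_ne_top P Q] with y hy
    exact RDP.perceptionPenalty_eq hy (hb y)
  have hform : ∀ᵐ x ∂P, κ x ≪ Q ∧ Q ≪ κ x ∧ Integrable (RDP.gibbsWeight Δ f ξ P Q β₁ β₂ x) Q ∧
      0 < ∫ y', RDP.gibbsWeight Δ f ξ P Q β₁ β₂ x y' ∂Q ∧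
      ∀ᵐ y ∂Q, (κ x).rnDeriv Q y = ENNReal.ofReal (RDP.gibbsWeight Δ f ξ P Q β₁ β₂ x y /
        ∫ y', RDP.gibbsWeight Δ f ξ P Q β₁ β₂ x y' ∂Q) := by
    filter_upwards [hκr, hgibbs] with x hκx hx
    obtain ⟨a, ha⟩ := hx
    have hrm : Measurable fun y => ENNReal.ofReal (r (x, y)) :=
      (hr.measurable.comp measurable_prodMk_left).ennreal_ofReal
    have hκx' : κ x = Q.withDensity fun y => ENNReal.ofReal (r (x, y)) := by
      rw [hκx, RDP.densityChannel_apply hr.toIsCondDensity]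
    have hw : ∀ᵐ y ∂Q, Real.exp (-a) * r (x, y) = RDP.gibbsWeight Δ f ξ P Q β₁ β₂ x y := by
      filter_upwards [ha, hpen] with y h1 h2
      rw [h1.2, ← mul_assoc, ← Real.exp_add, neg_add_cancel, Real.exp_zero, one_mul,
        RDP.gibbsWeight, h2]
      rfl
    have hwi := ((hr.integrable x).const_mul (Real.exp (-a))).congr hw
    have hZ : ∫ y', RDP.gibbsWeight Δ f ξ P Q β₁ β₂ x y' ∂Q = Real.exp (-a) := by
      rw [← integral_congr_ae hw, integral_const_mul, hr.integral_eq_one, mul_one]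
    refine ⟨?_, ?_, hwi, hZ ▸ Real.exp_pos _, ?_⟩
    · rw [hκx']
      exact withDensity_absolutelyContinuous _ _
    · rw [hκx']
      refine withDensity_absolutelyContinuous' hrm.aemeasurable ?_
      filter_upwards [ha] with y h1 using (ENNReal.ofReal_pos.2 h1.1).ne'
    · rw [hκx', hZ]
      filter_upwards [Measure.rnDeriv_withDensity Q hrm, hw] with y h1 h2
      rw [h1, ← h2, mul_div_cancel_left₀ _ (Real.exp_pos _).ne']
  refine ⟨ξ, ?_, ?_, ?_, ?_⟩
  · exact (((RDP.measurable_genExt hf).comp hsm).ereal_toReal.sub hbm).div hsm.ennreal_toReal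
  · filter_upwards [Measure.rnDeriv_ne_top P Q] with y hy hpos
    exact RDP.isSubgradient_of_persp hpos hy (hb y)
  · filter_upwards [hform] with x hx
    exact ⟨hx.1, hx.2.1, hx.2.2.1, hx.2.2.2.2⟩
  · intro Ω _ μ _ τ Xhat hcode
    filter_upwards [hform] with x hx
    obtain ⟨h1, h2, -, hZ, h3⟩ := hx
    have hrn : ∀ᵐ y ∂Q, Q.rnDeriv (κ x) y = (ENNReal.ofReal
        (RDP.gibbsWeight Δ f ξ P Q β₁ β₂ x y /
          ∫ y', RDP.gibbsWeight Δ f ξ P Q β₁ β₂ x y' ∂Q))⁻¹ := by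
      filter_upwards [h2.ae_le (Measure.inv_rnDeriv h1), h3] with y e1 e2
      rw [← e1, Pi.inv_apply, e2]
    have hall : ∀ᵐ ω ∂μ, ∀ i, Q.rnDeriv (κ x) (Xhat i ω) = (ENNReal.ofReal
        (RDP.gibbsWeight Δ f ξ P Q β₁ β₂ x (Xhat i ω) /
          ∫ y', RDP.gibbsWeight Δ f ξ P Q β₁ β₂ x y' ∂Q))⁻¹ := by
      refine ae_all_iff.2 fun i => ?_
      have h4 : ∀ᵐ y ∂(μ.map (Xhat i)), Q.rnDeriv (κ x) y = (ENNReal.ofReal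
          (RDP.gibbsWeight Δ f ξ P Q β₁ β₂ x y /
            ∫ y', RDP.gibbsWeight Δ f ξ P Q β₁ β₂ x y' ∂Q))⁻¹ := by
        rw [hcode.law_codeword i]
        exact hrn
      exact ae_of_ae_map (hcode.measurable_codeword i).aemeasurable h4
    filter_upwards [hall, hcode.ae_arrival_pos] with ω hω hW k
    exact RDP.isMinOn_pfrObjective_iff hβ₁ hZ hW hω k
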